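/- Fix an odd prime $\ell$. For $g \ge 0$ let $\mathrm{GSp}_{2g}(\mathbb{Z}_\ell)$ be the group of matrices $M \in \mathrm{GL}_{2g}(\mathbb{Z}_\ell)$ for which there is a unit $m \in \mathbb{Z}_\ell^\times$ with $\langle Mx, My\rangle = m\langle x, y\rangle$ for all $x, y \in \mathbb{Z}_\ell^{2g}$, where $\langle\cdot,\cdot\rangle$ is the standard symplectic pairing. Let $G_g = \mathbb{Z}_\ell^{2g} \rtimes \mathrm{GSp}_{2g}(\mathbb{Z}_\ell)$ be the semidirect product for the natural action of matrices on vectors, a profinite group (with the $\ell$-adic topology), and let $\mu_g$ be its Haar measure, normalized so that $\mu_g(G_g) = 1$. For each $n \ge 0$ the group $G_g$ acts on $(\mathbb{Z}/\ell^n\mathbb{Z})^{2g}$ by the affine maps $(a, M)\cdot x = a + Mx \bmod \ell^n$. Let $T_g$ be the complete $\ell^{2g}$-ary rooted tree whose vertices of level $n$ are the elements of $(\mathbb{Z}/\ell^n\mathbb{Z})^{2g}$, the parent of a vertex of level $n+1$ being its reduction modulo $\ell^n$; the group $G_g$ acts on $T_g$, and hence on the set of its ends $\varprojlim_n (\mathbb{Z}/\ell^n\mathbb{Z})^{2g}$.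 Put $$\mathcal{F}\bigl(\mathbb{Z}_\ell^{2g} \rtimes \mathrm{GSp}_{2g}(\mathbb{Z}_\ell)\bigr) = \mu_g\bigl(\{s \in G_g : s \text{ fixes at least one end of } T_g\}\bigr).$$ Then the limit $\lim_{g \to \infty} \mathcal{F}\bigl(\mathbb{Z}_\ell^{2g} \rtimes \mathrm{GSp}_{2g}(\mathbb{Z}_\ell)\bigr)$ exists (in $\mathbb{R}$). -/

import Mathlib

open Matrix MeasureTheory Filter Topology

/-! ### Groups acting on a rooted tree, and the measure of elements fixing an end -/

/-- The ends of a rooted tree with level sets `U 0, U 1, …`, where `π n` sends a vertex of level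
`n + 1` to its parent: the inverse limit of the level sets. -/
def TreeEnds (U : ℕ → Type*) (π : ∀ n, U (n + 1) → U n) : Type _ :=
  {x : ∀ n, U n // ∀ n, π n (x (n + 1)) = x n}

/-- For a compact topological group `G` acting on the levels of a rooted tree: the Haar measure,
normalized to total mass one, of the set of `g ∈ G` which fix at least one end of the tree. -/
noncomputable def fixedEndMeasure (G : Type*) [Group G] [TopologicalSpace G]
    [IsTopologicalGroup G] [CompactSpace G] [MeasurableSpace G] [BorelSpace G]
    (U : ℕ → Type*) [∀ n, MulAction G (U n)] (π : ∀ n, U (n + 1) → U n) : ℝ :=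
  (Measure.haarMeasure (⊤ : TopologicalSpace.PositiveCompacts G)).real
    {g : G | ∃ x : TreeEnds U π, ∀ n, g • x.1 n = x.1 n}

/-! ### The group of symplectic similitudes -/

/-- `GSp_{2g}(R)`: the invertible `2g × 2g` matrices `M` which multiply the standard symplectic
pairing by a unit `m` (the multiplier): `⟨M x, M y⟩ = m ⟨x, y⟩`. -/
def GSp (g : ℕ) (R : Type*) [CommRing R] : Subgroup (GL (Fin g ⊕ Fin g) R) where
  carrier := {M | ∃ m : Rˣ, (M : Matrix (Fin g ⊕ Fin g) (Fin g ⊕ Fin g) R)ᵀ * J (Fin g) R *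
    (M : Matrix (Fin g ⊕ Fin g) (Fin g ⊕ Fin g) R) = (m : R) • J (Fin g) R}
  one_mem' := ⟨1, by simp⟩
  mul_mem' := by
    rintro A B ⟨a, ha⟩ ⟨b, hb⟩
    refine ⟨a * b, ?_⟩
    calc _ = (B : Matrix (Fin g ⊕ Fin g) (Fin g ⊕ Fin g) R)ᵀ *
          ((A : Matrix (Fin g ⊕ Fin g) (Fin g ⊕ Fin g) R)ᵀ * J (Fin g) R *
            (A : Matrix (Fin g ⊕ Fin g) (Fin g ⊕ Fin g) R)) *
          (B : Matrix (Fin g ⊕ Fin g) (Fin g ⊕ Fin g) R) := by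
            simp [Matrix.transpose_mul, Matrix.mul_assoc]
      _ = _ := by
            rw [ha, Matrix.mul_smul, Matrix.smul_mul, hb, smul_smul, Units.val_mul]
  inv_mem' := by
    rintro A ⟨a, ha⟩
    refine ⟨a⁻¹, ?_⟩
    have h1 : (A : Matrix (Fin g ⊕ Fin g) (Fin g ⊕ Fin g) R) *
        ((A⁻¹ : GL (Fin g ⊕ Fin g) R) : Matrix (Fin g ⊕ Fin g) (Fin g ⊕ Fin g) R) = 1 :=
      A.mul_inv
    have h2 : ((A⁻¹ : GL (Fin g ⊕ Fin g) R) : Matrix (Fin g ⊕ Fin g) (Fin g ⊕ Fin g) R)ᵀ *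
        (A : Matrix (Fin g ⊕ Fin g) (Fin g ⊕ Fin g) R)ᵀ = 1 := by
      rw [← Matrix.transpose_mul, h1, Matrix.transpose_one]
    generalize ((A⁻¹ : GL (Fin g ⊕ Fin g) R) : Matrix (Fin g ⊕ Fin g) (Fin g ⊕ Fin g) R) = B at *
    have h3 : J (Fin g) R = ((a⁻¹ : Rˣ) : R) • ((A : Matrix (Fin g ⊕ Fin g) (Fin g ⊕ Fin g) R)ᵀ *
        J (Fin g) R * (A : Matrix (Fin g ⊕ Fin g) (Fin g ⊕ Fin g) R)) := by
      rw [ha, smul_smul, Units.inv_mul, one_smul]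
    calc Bᵀ * J (Fin g) R * B
        = Bᵀ * (((a⁻¹ : Rˣ) : R) • ((A : Matrix (Fin g ⊕ Fin g) (Fin g ⊕ Fin g) R)ᵀ *
        J (Fin g) R * (A : Matrix (Fin g ⊕ Fin g) (Fin g ⊕ Fin g) R))) * B := by rw [← h3]
      _ = ((a⁻¹ : Rˣ) : R) • ((Bᵀ * (A : Matrix (Fin g ⊕ Fin g) (Fin g ⊕ Fin g) R)ᵀ) *
        J (Fin g) R * ((A : Matrix (Fin g ⊕ Fin g) (Fin g ⊕ Fin g) R) * B)) := by
          simp only [Matrix.mul_smul, Matrix.smul_mul, Matrix.mul_assoc]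
      _ = _ := by rw [h1, h2, Matrix.one_mul, Matrix.mul_one]

/-! ### The semidirect product `ℤ_ℓ^{2g} ⋊ GSp_{2g}(ℤ_ℓ)` -/

/-- The action of `GSp_{2g}(ℤ_ℓ)` on the group `ℤ_ℓ^{2g}` by matrix-vector multiplication. -/
noncomputable def gspAut (ℓ : ℕ) [Fact ℓ.Prime] (g : ℕ) :
    GSp g ℤ_[ℓ] →* MulAut (Multiplicative (Fin g ⊕ Fin g → ℤ_[ℓ])) where
  toFun M :=
    { toFun := fun v => Multiplicative.ofAdd
        (M.1.1 *ᵥ v.toAdd)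
      invFun := fun v => Multiplicative.ofAdd
        (M⁻¹.1.1 *ᵥ v.toAdd)
      left_inv := fun v => by
        have h : M⁻¹.1.1 *
          M.1.1 = 1 := M.1.inv_mul
        simp only []
        rw [toAdd_ofAdd, Matrix.mulVec_mulVec, h, Matrix.one_mulVec, ofAdd_toAdd]
      right_inv := fun v => by
        have h : M.1.1 *
          M⁻¹.1.1 = 1 := M.1.mul_inv
        simp only []
        rw [toAdd_ofAdd, Matrix.mulVec_mulVec, h, Matrix.one_mulVec, ofAdd_toAdd]
      map_mul' := fun v w => by
        rw [toAdd_mul, Matrix.mulVec_add, ofAdd_add] }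
  map_one' := by
    ext v : 1
    simp
  map_mul' M N := by
    ext v : 1
    simp [Matrix.mulVec_mulVec]

/-- The group `ℤ_ℓ^{2g} ⋊ GSp_{2g}(ℤ_ℓ)`, with `(a, M) (b, N) = (a + M b, M N)`. -/
abbrev AffGSp (ℓ : ℕ) [Fact ℓ.Prime] (g : ℕ) : Type :=
  SemidirectProduct (Multiplicative (Fin g ⊕ Fin g → ℤ_[ℓ])) (GSp g ℤ_[ℓ]) (gspAut ℓ g)

/-- The product topology, for the `ℓ`-adic topology on vectors and on matrices. -/
noncomputable instance (ℓ : ℕ) [Fact ℓ.Prime] (g : ℕ) : TopologicalSpace (AffGSp ℓ g) :=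
  TopologicalSpace.induced (fun x => (x.left, x.right)) inferInstance

noncomputable instance (ℓ : ℕ) [Fact ℓ.Prime] (g : ℕ) : MeasurableSpace (AffGSp ℓ g) := borel _

instance (ℓ : ℕ) [Fact ℓ.Prime] (g : ℕ) : BorelSpace (AffGSp ℓ g) := ⟨rfl⟩

instance (ℓ : ℕ) [Fact ℓ.Prime] (g : ℕ) : IsTopologicalGroup (AffGSp ℓ g) := by
  have hind : IsInducing (fun x : AffGSp ℓ g => (x.left, x.right)) := ⟨rfl⟩
  have hl : Continuous (fun x : AffGSp ℓ g => x.left) := continuous_fst.comp hind.continuous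
  have hr : Continuous (fun x : AffGSp ℓ g => x.right) := continuous_snd.comp hind.continuous
  have hact : Continuous (fun p : GSp g ℤ_[ℓ] × Multiplicative (Fin g ⊕ Fin g → ℤ_[ℓ]) =>
      gspAut ℓ g p.1 p.2) := by
    change Continuous (fun p : GSp g ℤ_[ℓ] × Multiplicative (Fin g ⊕ Fin g → ℤ_[ℓ]) =>
      Multiplicative.ofAdd (p.1.1.1 *ᵥ p.2.toAdd))
    refine continuous_ofAdd.comp (Continuous.matrix_mulVec ?_ ?_)
    · exact Units.continuous_val.comp (continuous_subtype_val.comp continuous_fst)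
    · exact continuous_toAdd.comp continuous_snd
  refine { continuous_mul := ?_, continuous_inv := ?_ }
  · refine hind.continuous_iff.2 (Continuous.prodMk ?_ ?_)
    · exact (hl.comp continuous_fst).mul
        (hact.comp ((hr.comp continuous_fst).prodMk (hl.comp continuous_snd)))
    · exact (hr.comp continuous_fst).mul (hr.comp continuous_snd)
  · exact hind.continuous_iff.2 ((hact.comp (hr.inv.prodMk hl.inv)).prodMk hr.inv)

instance (ℓ : ℕ) [Fact ℓ.Prime] (g : ℕ) : CompactSpace (GSp g ℤ_[ℓ]) := by
  have hM : CompactSpace (Matrix (Fin g ⊕ Fin g) (Fin g ⊕ Fin g) ℤ_[ℓ]) :=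
    inferInstanceAs (CompactSpace (Fin g ⊕ Fin g → Fin g ⊕ Fin g → ℤ_[ℓ]))
  have hGL : CompactSpace (GL (Fin g ⊕ Fin g) ℤ_[ℓ]) :=
    Units.instCompactSpaceOfT1SpaceOfContinuousMul
  have hv : Continuous (fun p : GL (Fin g ⊕ Fin g) ℤ_[ℓ] × ℤ_[ℓ]ˣ => p.1.1) :=
    Units.continuous_val.comp continuous_fst
  have hm : Continuous (fun p : GL (Fin g ⊕ Fin g) ℤ_[ℓ] × ℤ_[ℓ]ˣ => (p.2 : ℤ_[ℓ])) :=
    Units.continuous_val.comp continuous_snd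
  have hcl : IsClosed {p : GL (Fin g ⊕ Fin g) ℤ_[ℓ] × ℤ_[ℓ]ˣ |
      p.1.1ᵀ * J (Fin g) ℤ_[ℓ] * p.1.1 = (p.2 : ℤ_[ℓ]) • J (Fin g) ℤ_[ℓ]} :=
    isClosed_eq ((hv.matrix_transpose.matrix_mul continuous_const).matrix_mul hv)
      (hm.smul continuous_const)
  have himg := hcl.isCompact.image continuous_fst
  suffices hc : IsCompact ((GSp g ℤ_[ℓ] : Subgroup _) : Set (GL (Fin g ⊕ Fin g) ℤ_[ℓ])) from
    isCompact_iff_compactSpace.1 hc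
  convert himg using 1
  ext M
  constructor
  · rintro ⟨m, hm⟩
    exact ⟨(M, m), hm, rfl⟩
  · rintro ⟨⟨M', m⟩, hm, rfl⟩
    exact ⟨m, hm⟩

instance (ℓ : ℕ) [Fact ℓ.Prime] (g : ℕ) : CompactSpace (AffGSp ℓ g) := by
  have hN : CompactSpace (Multiplicative (Fin g ⊕ Fin g → ℤ_[ℓ])) :=
    inferInstanceAs (CompactSpace (Fin g ⊕ Fin g → ℤ_[ℓ]))
  have hind : IsInducing (fun x : AffGSp ℓ g => (x.left, x.right)) := ⟨rfl⟩
  refine ⟨hind.isCompact_iff.2 ?_⟩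
  have : (fun x : AffGSp ℓ g => (x.left, x.right)) '' Set.univ = Set.univ :=
    Set.eq_univ_of_forall fun p => ⟨⟨p.1, p.2⟩, trivial, rfl⟩
  rw [this]
  exact isCompact_univ

/-! ### The rooted tree with levels `(ℤ/ℓ^n)^{2g}` -/

/-- The vertices of level `n`: the set `(ℤ/ℓ^n)^{2g}`. -/
@[ext]
structure TreeLevel (ℓ g n : ℕ) : Type where
  /-- the vector underlying a vertex -/
  vec : Fin g ⊕ Fin g → ZMod (ℓ ^ n)

/-- The parent of a vertex of level `n + 1` is its reduction modulo `ℓ^n`. -/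
def treeParent (ℓ g n : ℕ) (x : TreeLevel ℓ g (n + 1)) : TreeLevel ℓ g n :=
  ⟨fun i => ZMod.castHom (pow_dvd_pow ℓ n.le_succ) (ZMod (ℓ ^ n)) (x.vec i)⟩

/-- `(a, M)` acts on the level `(ℤ/ℓ^n)^{2g}` by the affine map `x ↦ a + M x` modulo `ℓ^n`. -/
noncomputable instance (ℓ : ℕ) [Fact ℓ.Prime] (g n : ℕ) :
    MulAction (AffGSp ℓ g) (TreeLevel ℓ g n) where
  smul s x := ⟨(fun i => PadicInt.toZModPow n (s.left.toAdd i)) +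
    s.right.1.1.map (PadicInt.toZModPow n) *ᵥ x.vec⟩
  one_smul x := by
    refine TreeLevel.ext ?_
    change (fun _ => PadicInt.toZModPow n (0 : ℤ_[ℓ])) +
      (1 : Matrix (Fin g ⊕ Fin g) (Fin g ⊕ Fin g) ℤ_[ℓ]).map (PadicInt.toZModPow n) *ᵥ x.vec
        = x.vec
    rw [map_zero, Matrix.map_one _ (map_zero _) (map_one _), Matrix.one_mulVec]
    exact zero_add x.vec
  mul_smul s t x := by
    refine TreeLevel.ext ?_
    change (fun i => PadicInt.toZModPow n (s.left.toAdd i +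
        (s.right.1.1 *ᵥ t.left.toAdd) i)) +
      (s.right.1.1 * t.right.1.1).map (PadicInt.toZModPow n) *ᵥ x.vec =
      (fun i => PadicInt.toZModPow n (s.left.toAdd i)) +
      s.right.1.1.map (PadicInt.toZModPow n) *ᵥ
        ((fun j => PadicInt.toZModPow n (t.left.toAdd j)) +
        t.right.1.1.map (PadicInt.toZModPow n) *ᵥ x.vec)
    rw [Matrix.map_mul, Matrix.mulVec_add, Matrix.mulVec_mulVec, ← add_assoc]
    congr 1
    funext i
    rw [map_add, RingHom.map_mulVec]
    rfl

/-- `𝓕(ℤ_ℓ^{2g} ⋊ GSp_{2g}(ℤ_ℓ))`: the proportion of elements of this group that fix at least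
one end of the tree with levels `(ℤ/ℓ^n)^{2g}`, on which the group acts by affine maps. -/
noncomputable def fixedEndDensityGSp (ℓ : ℕ) [Fact ℓ.Prime] (g : ℕ) : ℝ :=
  fixedEndMeasure (AffGSp ℓ g) (TreeLevel ℓ g) (treeParent ℓ g)

/-!
An element `(a, M)` fixes an end of the tree if and only if `a` lies in the image of `M - 1`, so
its density is the mean of `1 / |coker (M - 1)|` over `GSp_{2g}(ℤ_ℓ)`. The proof that this mean
converges as `g → ∞` reduces it to counting orbits.

*Reduction to a finite level.* Let `R = ℤ/ℓⁿ` and `F = ℤ/ℓ`, let `Γ_g ≤ GSp_{2g}(R)` be the group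
of reductions modulo `ℓⁿ`, and for `M ∈ Γ_g` let `K` and `K₁` be the spaces of vectors fixed by `M`
in `R^{2g}` and in `F^{2g}`. The elements that fix a vertex of level `n` have density the mean over
`Γ_g` of `1 / |K|` (`haarMeasure_real_fixed_treeLevel`). If such an element has `|K| < ℓⁿ`, then it
fixes an end by Nakayama's lemma (`exists_end_of_card_lt`); so the error is at most `ℓ⁻ⁿ`,
uniformly in `g` (`abs_fixedEndDensityGSp_sub_le`), and it suffices to treat the mean of `1 / |K|`
for each `n`.

*Reduction to moments.* We have `|K₁| ≤ |K| ≤ |R|^{|K₁|}`. Hence the part with `dim K₁ > D`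
contributes at most `ℓ^{-D}`, and on the rest `1 / |K|` is a polynomial in `|K|`. It remains to
treat the mean of `1[dim K₁ = d] |K|^j` for fixed `d` and `j`.

*Inclusion–exclusion.* The quantity `1[dim K₁ = d] |K|^j` counts, up to a constant, pairs of a
tuple `x ∈ K^j` and a linearly independent tuple `w` in `K₁` of length `d` that spans `K₁`. The
last condition is expressed by inclusion–exclusion through the numbers of extensions of `w` to
linearly independent tuples of length `d + i` in `K₁`; the truncations of this formula have an
error bounded by their last term (`abs_sum_card_fixedBy_config_sub_le`). By the Cauchy–Frobenius
lemma the means of these numbers are the numbers of `Γ_g`-orbits on configurations (`Config`). The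
decisive point is that only those `(x, w)` matter for which every vector orthogonal to `w` lifts to
a vector orthogonal to `x`: this is automatic if `w` spans `K₁`
(`exists_lift_orthogonal_fixedVectors`), and it makes the number of orbits small enough.

*Orbits.* By an argument in the style of Witt's theorem with at most two transvections
(`exists_transvections_mulVec`, which needs `2` to be invertible), an additional vector of the
frame multiplies the number of orbits by at most `ℓ^{d + i}` (`card_orbits_config_succ_le`); so the
last term of the truncated formula decays exponentially, uniformly in `g`
(`card_orbits_config_div_le`). For `g` large there is a hyperbolic pair orthogonal to a given
configuration, which therefore can be moved into `R^{2(g-1)}`; so the number of orbits does not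
increase with `g` and is eventually constant (`exists_eventually_card_orbits_eq`). Hence the means
are uniform limits of convergent sequences.
-/

/-! ### The symplectic pairing and transvections -/

section Pairing

variable {R S : Type*} [CommRing R] [CommRing S] {g : ℕ}

/-- The standard symplectic pairing `⟨x, y⟩ = xᵀ J y` on `R^{2g}`. -/
noncomputable def sp (g : ℕ) (R : Type*) [CommRing R] : LinearMap.BilinForm R (Fin g ⊕ Fin g → R) :=
  Matrix.toBilin' (J (Fin g) R)

theorem sp_eq_dotProduct (x y : Fin g ⊕ Fin g → R) :
    sp g R x y = x ⬝ᵥ (J (Fin g) R *ᵥ y) :=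
  Matrix.toBilin'_apply' _ _ _

theorem sp_apply (x y : Fin g ⊕ Fin g → R) :
    sp g R x y = ∑ i, x (Sum.inr i) * y (Sum.inl i) - ∑ i, x (Sum.inl i) * y (Sum.inr i) := by
  rw [sp_eq_dotProduct, J, fromBlocks_mulVec]
  simp [dotProduct, Fintype.sum_sum_type, neg_mulVec, add_comm, sub_eq_add_neg]

theorem sp_self (x : Fin g ⊕ Fin g → R) : sp g R x x = 0 := by
  rw [sp_apply, sub_eq_zero]
  exact Finset.sum_congr rfl fun i _ => mul_comm _ _

theorem sp_swap (x y : Fin g ⊕ Fin g → R) : sp g R x y = -sp g R y x := by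
  simp only [sp_apply, neg_sub]
  congr 1 <;> exact Finset.sum_congr rfl fun i _ => mul_comm _ _

theorem map_sp (ρ : R →+* S) (x y : Fin g ⊕ Fin g → R) :
    ρ (sp g R x y) = sp g S (ρ ∘ x) (ρ ∘ y) := by
  simp [sp_apply]

/-- The standard symplectic pairing is perfect. -/
theorem exists_sp_eq_dotProduct (c : Fin g ⊕ Fin g → R) :
    ∃ u, J (Fin g) R *ᵥ u = c ∧ ∀ x, sp g R x u = x ⬝ᵥ c := by
  have h : J (Fin g) R *ᵥ (-(J (Fin g) R *ᵥ c)) = c := by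
    rw [mulVec_neg, mulVec_mulVec, J_squared, neg_mulVec, one_mulVec, neg_neg]
  exact ⟨_, h, fun x => by rw [sp_eq_dotProduct, h]⟩

theorem exists_sp_eq_functional (f : (Fin g ⊕ Fin g → R) →ₗ[R] R) :
    ∃ u, ∀ x, sp g R x u = f x := by
  obtain ⟨u, -, hu⟩ := exists_sp_eq_dotProduct fun i => f (Pi.single i 1)
  refine ⟨u, fun x => ?_⟩
  rw [hu, dotProduct]
  conv_rhs => rw [pi_eq_sum_univ' x, map_sum]
  exact Finset.sum_congr rfl fun i _ => by rw [map_smul, smul_eq_mul]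

theorem sp_nondegenerate (g : ℕ) (F : Type*) [Field F] : (sp g F).Nondegenerate := by
  refine Matrix.Nondegenerate.toBilin' (Matrix.nondegenerate_of_det_ne_zero ?_)
  exact (isUnit_det_J (Fin g) F).ne_zero

/-- A similitude multiplies the symplectic pairing by its multiplier. -/
theorem GSp.exists_sp_mulVec (M : GSp g R) :
    ∃ m : Rˣ, ∀ x y, sp g R (M.1.1 *ᵥ x) (M.1.1 *ᵥ y) = m * sp g R x y := by
  obtain ⟨m, hm⟩ := M.2
  refine ⟨m, fun x y => ?_⟩
  rw [sp_eq_dotProduct, dotProduct_mulVec, vecMul_mulVec, ← dotProduct_mulVec, mulVec_mulVec, hm,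
    smul_mulVec, dotProduct_smul, sp_eq_dotProduct, smul_eq_mul]

theorem GSp.sp_mulVec_eq_zero_iff (M : GSp g R) (x y : Fin g ⊕ Fin g → R) :
    sp g R (M.1.1 *ᵥ x) (M.1.1 *ᵥ y) = 0 ↔ sp g R x y = 0 := by
  obtain ⟨m, hm⟩ := GSp.exists_sp_mulVec M
  rw [hm, Units.mul_right_eq_zero]

theorem GSp.inv_mulVec_mulVec (M : GSp g R) (x : Fin g ⊕ Fin g → R) :
    M⁻¹.1.1 *ᵥ (M.1.1 *ᵥ x) = x := by
  rw [mulVec_mulVec, show M⁻¹.1.1 * M.1.1 = 1 from M.1.inv_mul, one_mulVec]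

theorem GSp.mulVec_inv_mulVec (M : GSp g R) (x : Fin g ⊕ Fin g → R) :
    M.1.1 *ᵥ (M⁻¹.1.1 *ᵥ x) = x := by
  rw [mulVec_mulVec, show M.1.1 * M⁻¹.1.1 = 1 from M.1.mul_inv, one_mulVec]

/-- Base change of symplectic similitudes along a ring homomorphism. -/
noncomputable def GSp.map (g : ℕ) (ρ : R →+* S) : GSp g R →* GSp g S :=
  ((Matrix.GeneralLinearGroup.map ρ).comp (GSp g R).subtype).codRestrict (GSp g S) (by
    rintro ⟨M, m, hm⟩
    refine ⟨Units.map ρ m, ?_⟩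
    have := congrArg (fun A => A.map ρ) hm
    simp only [Matrix.map_mul, transpose_map, map_J] at this
    refine this.trans ?_
    ext i j
    simp [← congrFun₂ (map_J (Fin g) ρ) i j])

theorem GSp.comp_mulVec (ρ : R →+* S) (M : GSp g R) (v : Fin g ⊕ Fin g → R) :
    ρ ∘ (M.1.1 *ᵥ v) = (GSp.map g ρ M).1.1 *ᵥ (ρ ∘ v) := by
  ext i
  exact RingHom.map_mulVec ρ _ _ _

/-- Coordinatewise application of a ring homomorphism `ρ`, as a `ρ`-semilinear map. -/
def redVec (g : ℕ) (ρ : R →+* S) : (Fin g ⊕ Fin g → R) →ₛₗ[ρ] (Fin g ⊕ Fin g → S) where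
  toFun v := ρ ∘ v
  map_add' v w := by ext; simp
  map_smul' c v := by ext; simp

theorem redVec_apply (ρ : R →+* S) (v : Fin g ⊕ Fin g → R) : redVec g ρ v = ρ ∘ v := rfl

theorem redVec_surjective {ρ : R →+* S} (hρ : Function.Surjective ρ) :
    Function.Surjective (redVec g ρ) :=
  hρ.comp_left

/-- The matrix of `v ↦ v + c ⟨u, v⟩ u`. -/
noncomputable def spTransvectionMatrix (u : Fin g ⊕ Fin g → R) (c : R) :
    Matrix (Fin g ⊕ Fin g) (Fin g ⊕ Fin g) R :=
  1 + c • vecMulVec u (u ᵥ* J (Fin g) R)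

theorem spTransvectionMatrix_mulVec (u : Fin g ⊕ Fin g → R) (c : R) (v : Fin g ⊕ Fin g → R) :
    spTransvectionMatrix u c *ᵥ v = v + (c * sp g R u v) • u := by
  rw [spTransvectionMatrix, add_mulVec, one_mulVec, smul_mulVec, vecMulVec_mulVec, sp_eq_dotProduct,
    dotProduct_mulVec]
  simp [mul_smul]

theorem spTransvectionMatrix_mul_neg (u : Fin g ⊕ Fin g → R) (c : R) :
    spTransvectionMatrix u c * spTransvectionMatrix u (-c) = 1 := by
  refine Matrix.mulVec_injective (funext fun v => ?_)
  rw [← mulVec_mulVec, spTransvectionMatrix_mulVec, spTransvectionMatrix_mulVec, one_mulVec,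
    map_add, map_smul, sp_self, smul_zero, add_zero, neg_mul, neg_smul, add_assoc, neg_add_cancel,
    add_zero]

/-- The symplectic transvection `v ↦ v + c ⟨u, v⟩ u`, as a similitude. -/
noncomputable def spTransvection (u : Fin g ⊕ Fin g → R) (c : R) : GSp g R :=
  ⟨⟨spTransvectionMatrix u c, spTransvectionMatrix u (-c), spTransvectionMatrix_mul_neg u c, by
    simpa using spTransvectionMatrix_mul_neg u (-c)⟩, 1, by
    change (spTransvectionMatrix u c)ᵀ * J (Fin g) R * spTransvectionMatrix u c = _
    rw [Units.val_one, one_smul]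
    refine (Matrix.toBilin' (R₁ := R)).injective (LinearMap.ext₂ fun x y => ?_)
    have h1 : Matrix.toBilin'
        ((spTransvectionMatrix u c)ᵀ * J (Fin g) R * spTransvectionMatrix u c) x y =
        sp g R (spTransvectionMatrix u c *ᵥ x) (spTransvectionMatrix u c *ᵥ y) := by
      rw [Matrix.toBilin'_apply', sp_eq_dotProduct, dotProduct_mulVec _ (J (Fin g) R),
        vecMul_mulVec, ← dotProduct_mulVec, mulVec_mulVec]
    rw [h1, spTransvectionMatrix_mulVec, spTransvectionMatrix_mulVec]
    change _ = sp g R x y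
    simp only [map_add, map_smul, LinearMap.add_apply, LinearMap.smul_apply, sp_self, smul_eq_mul]
    rw [sp_swap x u]
    ring⟩

theorem spTransvection_mulVec (u : Fin g ⊕ Fin g → R) (c : R) (v : Fin g ⊕ Fin g → R) :
    (spTransvection u c).1.1 *ᵥ v = v + (c * sp g R u v) • u :=
  spTransvectionMatrix_mulVec u c v

theorem spTransvection_mulVec_of_sp_eq_zero {u v : Fin g ⊕ Fin g → R} (c : R) (h : sp g R v u = 0) :
    (spTransvection u c).1.1 *ᵥ v = v := by
  rw [spTransvection_mulVec, sp_swap, h, neg_zero, mul_zero, zero_smul, add_zero]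

theorem GSp.ext_mulVec {M N : GSp g R} (h : ∀ v, M.1.1 *ᵥ v = N.1.1 *ᵥ v) : M = N :=
  Subtype.ext (Units.ext (Matrix.mulVec_injective (funext h)))

theorem map_spTransvection {ρ : R →+* S} (hρ : Function.Surjective ρ) (u : Fin g ⊕ Fin g → R)
    (c : R) :
    GSp.map g ρ (spTransvection u c) = spTransvection (ρ ∘ u) (ρ c) := by
  refine GSp.ext_mulVec fun v => ?_
  obtain ⟨v, rfl⟩ := hρ.comp_left v
  rw [← GSp.comp_mulVec, spTransvection_mulVec, spTransvection_mulVec, ← map_sp]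
  ext i
  simp

/-- If `y' - y` lies in a submodule `A` and neither `⟨y, ·⟩` nor `⟨y', ·⟩` takes only non-units as
values on `A`, then a product of two transvections along vectors of `A` takes `y` to `y'`: one goes
through an intermediate vector `y + u` that pairs to a unit with both `y` and `y'`. Such a `u`
exists because `2` is a unit: it is among `u₀`, `2 u₀`, `u₀ + v₀` and `u₀ - v₀`, if `u₀` and `v₀`
in `A` pair to a unit with `y` and `y'`, respectively. -/
theorem exists_transvections_mulVec {F : Type*} [Field F] (ρ : R →+* F) [IsLocalHom ρ]
    (h2 : (2 : F) ≠ 0) (A : Submodule R (Fin g ⊕ Fin g → R)) {y y' : Fin g ⊕ Fin g → R}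
    (hA : y' - y ∈ A) (hy : ∃ u ∈ A, ρ (sp g R y u) ≠ 0) (hy' : ∃ u ∈ A, ρ (sp g R y' u) ≠ 0) :
    ∃ u ∈ A, ∃ c, ∃ u' ∈ A, ∃ c',
      (spTransvection u' c').1.1 *ᵥ ((spTransvection u c).1.1 *ᵥ y) = y' := by
  have key : ∃ u ∈ A, ρ (sp g R y u) ≠ 0 ∧ ρ (sp g R (y + u) y') ≠ 0 := by
    obtain ⟨u, hu, hyu⟩ := hy
    obtain ⟨v, hv, hyv⟩ := hy'
    by_contra! H
    have hs : ∀ w ∈ A, ρ (sp g R y w) ≠ 0 → ρ (sp g R y y') - ρ (sp g R y' w) = 0 := by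
      intro w hw h
      have := H w hw h
      rwa [map_add, LinearMap.add_apply, map_add, sp_swap w y', map_neg, ← sub_eq_add_neg] at this
    have e1 := hs u hu hyu
    have e2 := hs ((2 : R) • u) (A.smul_mem _ hu) (by
      rw [map_smul, smul_eq_mul, map_mul, map_ofNat]; exact mul_ne_zero h2 hyu)
    rw [map_smul, smul_eq_mul, map_mul, map_ofNat] at e2
    have e3 : ρ (sp g R y' u) = 0 := by linear_combination e1 - e2
    have e4 := hs (u + v) (A.add_mem hu hv)
    have e5 := hs (u - v) (A.sub_mem hu hv)
    simp only [map_add, map_sub] at e4 e5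
    by_cases h : ρ (sp g R y u) + ρ (sp g R y v) = 0
    · refine hyv ?_
      have := e5 (fun h' => mul_ne_zero h2 hyu (by linear_combination h + h'))
      linear_combination this - e1
    · refine hyv ?_
      linear_combination e1 - e4 h
  obtain ⟨u, hu, h1, h2'⟩ := key
  obtain ⟨a, ha⟩ := isUnit_of_map_unit ρ _ (isUnit_iff_ne_zero.2 h1)
  obtain ⟨b, hb⟩ := isUnit_of_map_unit ρ _ (isUnit_iff_ne_zero.2 h2')
  refine ⟨u, hu, -(a⁻¹ : Rˣ), y' - (y + u), ?_, -(b⁻¹ : Rˣ), ?_⟩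
  · rw [← sub_sub]
    exact A.sub_mem hA hu
  · have h3 : (spTransvection u (-(a⁻¹ : Rˣ) : R)).1.1 *ᵥ y = y + u := by
      rw [spTransvection_mulVec, sp_swap, ← ha, neg_mul_neg, Units.inv_mul, one_smul]
    rw [h3, spTransvection_mulVec, sp_swap, map_sub, sp_self, sub_zero, ← hb, neg_mul_neg,
      Units.inv_mul, one_smul, add_sub_cancel]

end Pairing

/-! ### Configurations of vectors, and a bound for their number of orbits -/

/-- If a `G`-set `X` maps to `Y` equivariantly, and elements of a fibre with equal value of an
invariant `h` lie in one orbit, then `X` has at most `|Y/G| · |S|` orbits, `S` being the set of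
values of `h`. The map `h` need not be `G`-invariant. -/
theorem card_orbits_le_mul {G X Y S : Type*} [Group G] [MulAction G X] [MulAction G Y] [Finite Y]
    [Finite S] (f : X → Y) (hf : ∀ (a : G) x, f (a • x) = a • f x) (h : X → S)
    (H : ∀ x x', f x = f x' → h x = h x' → ∃ a : G, a • x = x') :
    Nat.card (MulAction.orbitRel.Quotient G X) ≤
      Nat.card (MulAction.orbitRel.Quotient G Y) * Nat.card S := by
  -- every orbit of `X` has an element lying over the chosen representative of an orbit of `Y`
  have key : ∀ q : MulAction.orbitRel.Quotient G X, ∃ x : X, (Quotient.mk'' x : _) = q ∧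
      ∃ p : MulAction.orbitRel.Quotient G Y, f x = p.out := by
    intro q
    induction q using Quotient.inductionOn' with | _ x
    have h1 : (Quotient.mk'' ((Quotient.mk'' (f x) : MulAction.orbitRel.Quotient G Y).out) :
        MulAction.orbitRel.Quotient G Y) = Quotient.mk'' (f x) := Quotient.out_eq' _
    obtain ⟨a, ha⟩ := Quotient.eq''.1 h1
    exact ⟨a • x, Quotient.sound' ⟨a, rfl⟩, _, (hf a x).trans ha⟩
  choose x hx p hp using key
  have hinj : Function.Injective fun q => (p q, h (x q)) := by
    intro q q' hq
    rw [Prod.mk.injEq] at hq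
    obtain ⟨a, ha⟩ := H (x q) (x q') (by rw [hp, hp, hq.1]) hq.2
    rw [← hx q, ← hx q']
    exact (Quotient.sound' ⟨a, ha⟩ :
      (Quotient.mk'' (x q') : MulAction.orbitRel.Quotient G X) = Quotient.mk'' (x q)).symm
  rw [← Nat.card_prod]
  exact Nat.card_le_card_of_injective _ hinj

section Config

variable {R F : Type*} [CommRing R] [Field F]

/-- Every vector over `F` orthogonal to all `w t` lifts to a vector over `R` orthogonal to all
`x s`. -/
def LiftsOrthogonal (ρ : R →+* F) {g j d : ℕ} (x : Fin j → Fin g ⊕ Fin g → R)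
    (w : Fin d → Fin g ⊕ Fin g → F) : Prop :=
  ∀ u, (∀ t, sp g F (w t) u = 0) → ∃ v, ρ ∘ v = u ∧ ∀ s, sp g R (x s) v = 0

/-- A tuple of `j` vectors over `R` and a linearly independent tuple of `d + i` vectors over the
residue field, such that vectors orthogonal to the first `d` of the latter lift to vectors
orthogonal to the former. -/
@[ext]
structure Config (ρ : R →+* F) (g j d i : ℕ) where
  /-- the vectors over `R` -/
  vecs : Fin j → Fin g ⊕ Fin g → R
  /-- the vectors over the residue field -/
  frame : Fin (d + i) → Fin g ⊕ Fin g → F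
  indep : LinearIndependent F frame
  good : LiftsOrthogonal ρ vecs fun t : Fin d => frame (Fin.castAdd i t)

variable {ρ : R →+* F} {g j d i : ℕ}

instance [Finite R] [Finite F] : Finite (Config ρ g j d i) :=
  Finite.of_injective (fun c => (c.vecs, c.frame)) fun c c' h => by
    rw [Prod.mk.injEq] at h
    exact Config.ext h.1 h.2

theorem LiftsOrthogonal.smul {x : Fin j → Fin g ⊕ Fin g → R} {w : Fin d → Fin g ⊕ Fin g → F}
    (h : LiftsOrthogonal ρ x w) (M : GSp g R) :
    LiftsOrthogonal ρ (fun s => M.1.1 *ᵥ x s) fun t => (GSp.map g ρ M).1.1 *ᵥ w t := by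
  intro u hu
  obtain ⟨v, hv, hx⟩ := h ((GSp.map g ρ M)⁻¹.1.1 *ᵥ u) fun t => by
    rw [← GSp.sp_mulVec_eq_zero_iff (GSp.map g ρ M), GSp.mulVec_inv_mulVec]
    exact hu t
  refine ⟨M.1.1 *ᵥ v, ?_, fun s => (GSp.sp_mulVec_eq_zero_iff M _ _).2 (hx s)⟩
  rw [GSp.comp_mulVec, hv, GSp.mulVec_inv_mulVec]

theorem GSp.mulVec_injective (M : GSp g R) : Function.Injective fun v => M.1.1 *ᵥ v :=
  Function.LeftInverse.injective (g := fun v => M⁻¹.1.1 *ᵥ v) (GSp.inv_mulVec_mulVec M)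

noncomputable instance : MulAction (GSp g R) (Config ρ g j d i) where
  smul M c :=
    { vecs := fun s => M.1.1 *ᵥ c.vecs s
      frame := fun t => (GSp.map g ρ M).1.1 *ᵥ c.frame t
      indep := c.indep.map' (Matrix.mulVecLin (GSp.map g ρ M).1.1)
        (LinearMap.ker_eq_bot.2 (GSp.mulVec_injective _))
      good := c.good.smul M }
  one_smul c := by
    refine Config.ext (funext fun s => one_mulVec (c.vecs s)) (funext fun t => ?_)
    change (GSp.map g ρ 1).1.1 *ᵥ c.frame t = c.frame t
    rw [map_one]
    exact one_mulVec (c.frame t)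
  mul_smul M N c := by
    refine Config.ext (funext fun s => ?_) (funext fun t => ?_)
    · exact (mulVec_mulVec (c.vecs s) _ _).symm
    · change (GSp.map g ρ (M * N)).1.1 *ᵥ c.frame t = _
      rw [map_mul]
      exact (mulVec_mulVec (c.frame t) _ _).symm

theorem Config.smul_frame (M : GSp g R) (c : Config ρ g j d i) (t : Fin (d + i)) :
    (M • c).frame t = (GSp.map g ρ M).1.1 *ᵥ c.frame t := rfl

/-- Forget the last vector of the frame. -/
def Config.init (c : Config ρ g j d (i + 1)) : Config ρ g j d i where
  vecs := c.vecs
  frame := fun t => c.frame t.castSucc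
  indep := c.indep.comp _ (Fin.castSucc_injective _)
  good := c.good

/-- Outside the span of the first vectors of the frame, a vector over the residue field is
determined up to transvections fixing all other vectors by its pairings with them: the last vector
of a frame pairs non-trivially with the orthogonal complement `A` of the others, so transvections
along `A` move it anywhere the pairings allow; and vectors of `A` lift to vectors orthogonal to the
`vecs`. -/
theorem Config.exists_smul_eq (hρ : Function.Surjective ρ) (h2 : (2 : F) ≠ 0)
    {Γ : Subgroup (GSp g R)} (hΓ : ∀ u c, spTransvection u c ∈ Γ) {c c' : Config ρ g j d (i + 1)}
    (hinit : c.init = c'.init)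
    (hsp : ∀ t : Fin (d + i), sp g F (c.frame t.castSucc) (c.frame (Fin.last _)) =
      sp g F (c'.frame t.castSucc) (c'.frame (Fin.last _))) :
    ∃ a : Γ, a • c = c' := by
  have hvecs : c.vecs = c'.vecs := congrArg (fun b => b.vecs) hinit
  have hframe : ∀ t : Fin (d + i), c.frame t.castSucc = c'.frame t.castSucc :=
    fun t => congrFun (congrArg (fun b => b.frame) hinit) t
  let A : Submodule F (Fin g ⊕ Fin g → F) :=
    ⨅ t : Fin (d + i), LinearMap.ker (sp g F (c.frame t.castSucc))
  have memA : ∀ u, u ∈ A ↔ ∀ t : Fin (d + i), sp g F (c.frame t.castSucc) u = 0 := fun u => by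
    simp [A, Submodule.mem_iInf]
  have hout : ∀ b : Config ρ g j d (i + 1),
      (∀ t : Fin (d + i), c.frame t.castSucc = b.frame t.castSucc) →
      ∃ u ∈ A, RingHom.id F (sp g F (b.frame (Fin.last _)) u) ≠ 0 := by
    intro b hb
    have hind := b.indep
    rw [← Fin.snoc_init_self b.frame, linearIndependent_finSnoc] at hind
    obtain ⟨f, hf, hle⟩ := Submodule.exists_le_ker_of_notMem hind.2
    obtain ⟨u, hu⟩ := exists_sp_eq_functional f
    refine ⟨u, (memA u).2 fun t => ?_, by rw [hu]; exact hf⟩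
    rw [hu, hb]
    exact hle (Submodule.subset_span ⟨t, rfl⟩)
  obtain ⟨u, hu, a, u', hu', a', h⟩ := exists_transvections_mulVec (RingHom.id F) h2 A
    (y := c.frame (Fin.last _)) (y' := c'.frame (Fin.last _))
    ((memA _).2 fun t => by rw [map_sub, hsp, hframe, sub_self])
    (hout c fun t => rfl) (hout c' hframe)
  rw [memA] at hu hu'
  obtain ⟨v, rfl, hv⟩ := c.good u fun t => hu (Fin.castAdd i t)
  obtain ⟨v', rfl, hv'⟩ := c.good u' fun t => hu' (Fin.castAdd i t)
  obtain ⟨b, rfl⟩ := hρ a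
  obtain ⟨b', rfl⟩ := hρ a'
  refine ⟨⟨_, hΓ v' b'⟩ * ⟨_, hΓ v b⟩, ?_⟩
  rw [mul_smul]
  refine Config.ext (funext fun s => ?_) (funext fun t => ?_)
  · change (spTransvection v' b').1.1 *ᵥ ((spTransvection v b).1.1 *ᵥ c.vecs s) = _
    rw [spTransvection_mulVec_of_sp_eq_zero _ (hv s), spTransvection_mulVec_of_sp_eq_zero _ (hv' s),
      hvecs]
  · change (GSp.map g ρ (spTransvection v' b')).1.1 *ᵥ
      ((GSp.map g ρ (spTransvection v b)).1.1 *ᵥ c.frame t) = _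
    rw [map_spTransvection hρ, map_spTransvection hρ]
    induction t using Fin.lastCases with
    | last => exact h
    | cast t =>
      rw [spTransvection_mulVec_of_sp_eq_zero _ (hu t),
        spTransvection_mulVec_of_sp_eq_zero _ (hu' t), hframe]

theorem card_orbits_config_succ_le [Finite R] [Finite F] (hρ : Function.Surjective ρ)
    (h2 : (2 : F) ≠ 0) {Γ : Subgroup (GSp g R)} (hΓ : ∀ u c, spTransvection u c ∈ Γ) :
    Nat.card (MulAction.orbitRel.Quotient Γ (Config ρ g j d (i + 1))) ≤
      Nat.card (MulAction.orbitRel.Quotient Γ (Config ρ g j d i)) * Nat.card F ^ (d + i) := by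
  have := card_orbits_le_mul (G := Γ) (X := Config ρ g j d (i + 1)) (Y := Config ρ g j d i)
    Config.init (fun _ _ => rfl)
    (fun c (t : Fin (d + i)) => sp g F (c.frame t.castSucc) (c.frame (Fin.last _)))
    fun c c' h1 h2' => Config.exists_smul_eq hρ h2 hΓ h1 fun t => congrFun h2' t
  rwa [Nat.card_fun, Nat.card_fin] at this

end Config

/-! ### Stabilization of the number of orbits as `g` grows -/

section Embedding

variable {R F : Type*} [CommRing R] [Field F] {g : ℕ}

/-- The inclusion `R^{2g} → R^{2(g+1)}` as the vectors whose first symplectic pair of coordinates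
vanishes. -/
def spEmb (g : ℕ) (R : Type*) [CommRing R] :
    (Fin g ⊕ Fin g → R) →ₗ[R] (Fin (g + 1) ⊕ Fin (g + 1) → R) where
  toFun v := Sum.elim (Fin.cons 0 (v ∘ Sum.inl)) (Fin.cons 0 (v ∘ Sum.inr))
  map_add' v w := by
    ext (k | k) <;> induction k using Fin.cases <;> simp
  map_smul' c v := by
    ext (k | k) <;> induction k using Fin.cases <;> simp

/-- The projection `R^{2(g+1)} → R^{2g}` forgetting the first symplectic pair of coordinates. -/
def spProj (g : ℕ) (R : Type*) [CommRing R] :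
    (Fin (g + 1) ⊕ Fin (g + 1) → R) →ₗ[R] (Fin g ⊕ Fin g → R) :=
  LinearMap.funLeft R R (Sum.map Fin.succ Fin.succ)

theorem spProj_apply (v : Fin (g + 1) ⊕ Fin (g + 1) → R) :
    spProj g R v = v ∘ Sum.map Fin.succ Fin.succ := rfl

theorem spProj_spEmb (v : Fin g ⊕ Fin g → R) : spProj g R (spEmb g R v) = v := by
  ext (k | k) <;> simp [spProj_apply, spEmb]

theorem spEmb_spProj {v : Fin (g + 1) ⊕ Fin (g + 1) → R} (hl : v (Sum.inl 0) = 0)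
    (hr : v (Sum.inr 0) = 0) : spEmb g R (spProj g R v) = v := by
  ext (k | k) <;> induction k using Fin.cases <;> simp [spProj_apply, spEmb, hl, hr]

theorem sp_spEmb_left (v : Fin g ⊕ Fin g → R) (w : Fin (g + 1) ⊕ Fin (g + 1) → R) :
    sp (g + 1) R (spEmb g R v) w = sp g R v (spProj g R w) := by
  simp [sp_apply, spProj_apply, spEmb, Fin.sum_univ_succ]

theorem comp_spEmb (ρ : R →+* F) (v : Fin g ⊕ Fin g → R) :
    ρ ∘ spEmb g R v = spEmb g F (ρ ∘ v) := by
  ext (k | k) <;> induction k using Fin.cases <;> simp [spEmb]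

theorem sp_single_inl (v : Fin (g + 1) ⊕ Fin (g + 1) → R) :
    sp (g + 1) R v (Pi.single (Sum.inl 0) 1) = v (Sum.inr 0) := by
  simp [sp_apply, Pi.single_apply]

theorem sp_single_inr (v : Fin (g + 1) ⊕ Fin (g + 1) → R) :
    sp (g + 1) R v (Pi.single (Sum.inr 0) 1) = -v (Sum.inl 0) := by
  simp [sp_apply, Pi.single_apply]

theorem sp_spTransvection (u : Fin g ⊕ Fin g → R) (c : R) (x y : Fin g ⊕ Fin g → R) :
    sp g R ((spTransvection u c).1.1 *ᵥ x) ((spTransvection u c).1.1 *ᵥ y) = sp g R x y := by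
  simp only [spTransvection_mulVec, map_add, map_smul, LinearMap.add_apply, LinearMap.smul_apply,
    sp_self, smul_eq_mul]
  rw [sp_swap x u]
  ring

/-- The group generated by the transvections is transitive on hyperbolic pairs. -/
theorem exists_mulVec_eq_single (ρ : R →+* F) [IsLocalHom ρ] (h2 : (2 : F) ≠ 0)
    {Γ : Subgroup (GSp (g + 1) R)} (hΓ : ∀ u c, spTransvection u c ∈ Γ)
    {a b : Fin (g + 1) ⊕ Fin (g + 1) → R} (hab : sp (g + 1) R b a = 1) :
    ∃ M ∈ Γ, M.1.1 *ᵥ a = Pi.single (Sum.inl 0) 1 ∧ M.1.1 *ᵥ b = Pi.single (Sum.inr 0) 1 := by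
  obtain ⟨u₁, -, c₁, u₂, -, c₂, h⟩ := exists_transvections_mulVec ρ h2 ⊤
    (y := a) (y' := Pi.single (Sum.inl 0) 1) trivial
    ⟨b, trivial, by rw [sp_swap, hab]; simp⟩
    ⟨Pi.single (Sum.inr 0) 1, trivial, by rw [sp_single_inr]; simp⟩
  set b' := (spTransvection u₂ c₂).1.1 *ᵥ ((spTransvection u₁ c₁).1.1 *ᵥ b) with hb'
  have hb1 : sp (g + 1) R b' (Pi.single (Sum.inl 0) 1) = 1 := by
    rw [← h, hb', sp_spTransvection, sp_spTransvection, hab]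
  have hf1 : sp (g + 1) R (Pi.single (Sum.inr 0) 1) (Pi.single (Sum.inl 0) 1) = 1 := by
    rw [sp_single_inl]; simp
  have memA : (Pi.single (Sum.inl 0) 1 : Fin (g + 1) ⊕ Fin (g + 1) → R) ∈
      LinearMap.ker (sp (g + 1) R (Pi.single (Sum.inl 0) 1)) := sp_self _
  obtain ⟨u₃, h3, c₃, u₄, h4, c₄, h'⟩ := exists_transvections_mulVec ρ h2
    (LinearMap.ker (sp (g + 1) R (Pi.single (Sum.inl 0) 1)))
    (y := b') (y' := Pi.single (Sum.inr 0) 1)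
    (by rw [LinearMap.mem_ker, sp_swap, map_sub, LinearMap.sub_apply, hb1, hf1, sub_self, neg_zero])
    ⟨_, memA, by rw [hb1]; simp⟩ ⟨_, memA, by rw [hf1]; simp⟩
  refine ⟨spTransvection u₄ c₄ * spTransvection u₃ c₃ *
    (spTransvection u₂ c₂ * spTransvection u₁ c₁),
    mul_mem (mul_mem (hΓ _ _) (hΓ _ _)) (mul_mem (hΓ _ _) (hΓ _ _)), ?_, ?_⟩
  · change ((spTransvection u₄ c₄).1.1 * (spTransvection u₃ c₃).1.1 *
      ((spTransvection u₂ c₂).1.1 * (spTransvection u₁ c₁).1.1)) *ᵥ a = _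
    rw [← mulVec_mulVec, ← mulVec_mulVec, ← mulVec_mulVec, h,
      spTransvection_mulVec_of_sp_eq_zero _ h3, spTransvection_mulVec_of_sp_eq_zero _ h4]
  · change ((spTransvection u₄ c₄).1.1 * (spTransvection u₃ c₃).1.1 *
      ((spTransvection u₂ c₂).1.1 * (spTransvection u₁ c₁).1.1)) *ᵥ b = _
    rw [← mulVec_mulVec, ← mulVec_mulVec, ← mulVec_mulVec, ← hb', h']

/-- A submodule of `R^{2g}` on which the symplectic pairing takes no unit as a value is small,
because its image over the residue field is totally isotropic. -/
theorem card_le_of_isotropic [Finite R] [Finite F] {ρ : R →+* F} (hρ : Function.Surjective ρ)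
    (A : Submodule R (Fin g ⊕ Fin g → R)) (hA : ∀ a ∈ A, ∀ b ∈ A, ρ (sp g R a b) = 0) :
    Nat.card A * Nat.card F ^ g ≤ Nat.card R ^ (2 * g) := by
  let _ : RingHomSurjective ρ := ⟨hρ⟩
  let f := redVec g ρ
  have hf : Function.Surjective f := redVec_surjective hρ
  let B := A.map f
  have hB : B ≤ (sp g F).orthogonal B := by
    rintro _ ⟨a, ha, rfl⟩ _ ⟨b, hb, rfl⟩
    exact (map_sp ρ b a).symm.trans (hA b hb a ha)
  have hdim : Module.finrank F B ≤ g := by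
    have h1 := LinearMap.BilinForm.finrank_orthogonal (sp_nondegenerate g F) B
    have h2 := Submodule.finrank_mono hB
    rw [Module.finrank_fintype_fun_eq_card, Fintype.card_sum, Fintype.card_fin] at h1
    omega
  have hBcard : Nat.card B ≤ Nat.card F ^ g := by
    rw [Module.natCard_eq_pow_finrank (K := F)]
    exact Nat.pow_le_pow_right Nat.card_pos hdim
  have hV : Nat.card (Fin g ⊕ Fin g → R) = Nat.card R ^ (2 * g) := by
    rw [Nat.card_fun, Nat.card_sum, Nat.card_fin, two_mul]
  have hV' : Nat.card (Fin g ⊕ Fin g → F) = Nat.card F ^ g * Nat.card F ^ g := by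
    rw [Nat.card_fun, Nat.card_sum, Nat.card_fin, pow_add]
  have h1 : Nat.card A ≤ Nat.card f.toAddMonoidHom.ker * Nat.card B := by
    let h : A.toAddSubgroup →+ B.toAddSubgroup :=
      (f.toAddMonoidHom.comp A.toAddSubgroup.subtype).codRestrict B.toAddSubgroup
        fun a => ⟨a, a.2, rfl⟩
    rw [show Nat.card A = Nat.card A.toAddSubgroup from rfl,
      AddSubgroup.card_eq_card_quotient_mul_card_addSubgroup h.ker, mul_comm]
    refine Nat.mul_le_mul (Nat.card_le_card_of_injective
      (fun x : h.ker => (⟨x.1.1, congrArg Subtype.val x.2⟩ : f.toAddMonoidHom.ker))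
      fun x y hxy => Subtype.ext (Subtype.ext (Subtype.mk.inj hxy))) ?_
    exact Nat.card_le_card_of_injective _ (QuotientAddGroup.kerLift_injective h)
  have h2 : Nat.card (Fin g ⊕ Fin g → R) =
      Nat.card (Fin g ⊕ Fin g → F) * Nat.card f.toAddMonoidHom.ker := by
    rw [AddSubgroup.card_eq_card_quotient_mul_card_addSubgroup f.toAddMonoidHom.ker]
    congr 1
    exact Nat.card_congr
      (QuotientAddGroup.quotientKerEquivOfSurjective f.toAddMonoidHom hf).toEquiv
  rw [← hV, h2, hV']
  calc Nat.card A * Nat.card F ^ g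
      ≤ Nat.card f.toAddMonoidHom.ker * Nat.card F ^ g * Nat.card F ^ g := by
        gcongr
        exact h1.trans (by gcongr)
    _ = _ := by ring

/-- If `g` is large compared with the number of given vectors in `R^{2g}`, there is a hyperbolic
pair orthogonal to all of them: otherwise their orthogonal complement would be too large for
`card_le_of_isotropic`. -/
theorem exists_hyperbolic_pair [Finite R] [Finite F] {ρ : R →+* F} [IsLocalHom ρ]
    (hρ : Function.Surjective ρ) {κ : Type*} [Fintype κ] (c : κ → Fin g ⊕ Fin g → R)
    (hg : Nat.card R ^ Fintype.card κ < Nat.card F ^ g) :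
    ∃ a b, (∀ s, sp g R (c s) a = 0) ∧ (∀ s, sp g R (c s) b = 0) ∧ sp g R b a = 1 := by
  let f : (Fin g ⊕ Fin g → R) →ₗ[R] (κ → R) := LinearMap.pi fun s => sp g R (c s)
  have memf : ∀ a, a ∈ LinearMap.ker f ↔ ∀ s, sp g R (c s) a = 0 := fun a => by
    simp [f, LinearMap.mem_ker, funext_iff]
  have hcard : Nat.card R ^ (2 * g) ≤ Nat.card R ^ Fintype.card κ * Nat.card (LinearMap.ker f) := by
    have h1 : Nat.card (Fin g ⊕ Fin g → R) = Nat.card R ^ (2 * g) := by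
      rw [Nat.card_fun, Nat.card_sum, Nat.card_fin, two_mul]
    rw [← h1, Submodule.card_eq_card_quotient_mul_card (LinearMap.ker f), mul_comm]
    refine Nat.mul_le_mul ?_ le_rfl
    rw [← Nat.card_eq_fintype_card, ← Nat.card_fun]
    exact Nat.card_le_card_of_injective _
      (LinearMap.ker_eq_bot.1 (Submodule.ker_liftQ_eq_bot _ f le_rfl le_rfl))
  have : ∃ a ∈ LinearMap.ker f, ∃ b ∈ LinearMap.ker f, ρ (sp g R b a) ≠ 0 := by
    by_contra! H
    have h2 := card_le_of_isotropic hρ (LinearMap.ker f) fun a ha b hb => H b hb a ha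
    have h3 : 0 < Nat.card (LinearMap.ker f) := Nat.card_pos
    nlinarith
  obtain ⟨a, ha, b, hb, hab⟩ := this
  obtain ⟨e, he⟩ := isUnit_of_map_unit ρ _ (isUnit_iff_ne_zero.2 hab)
  refine ⟨a, (e⁻¹ : Rˣ).1 • b, (memf a).1 ha, fun s => ?_, ?_⟩
  · rw [map_smul, (memf b).1 hb, smul_zero]
  · rw [map_smul, LinearMap.smul_apply, ← he, smul_eq_mul, Units.inv_mul]

end Embedding

section Stabilization

variable {R F : Type*} [CommRing R] [Field F] {ρ : R →+* F} {g j d i : ℕ}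

/-- A family of groups of similitudes of `R^{2g}`, one for each `g`, that contain the transvections
and whose elements extend from `R^{2g}` to `R^{2(g+1)}`. -/
structure IsStableFamily (Γ : ∀ g, Subgroup (GSp g R)) : Prop where
  transvection_mem : ∀ g (u : Fin g ⊕ Fin g → R) c, spTransvection u c ∈ Γ g
  extend : ∀ g, ∀ M ∈ Γ g, ∃ M' ∈ Γ (g + 1), ∀ v,
    M'.1.1 *ᵥ spEmb g R v = spEmb g R (M.1.1 *ᵥ v)

/-- A configuration in genus `g` is a configuration in genus `g + 1`. -/
noncomputable def Config.emb (hρ : Function.Surjective ρ) (c : Config ρ g j d i) :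
    Config ρ (g + 1) j d i where
  vecs := fun s => spEmb g R (c.vecs s)
  frame := fun t => spEmb g F (c.frame t)
  indep := c.indep.map' (spEmb g F)
    (LinearMap.ker_eq_bot.2 (Function.LeftInverse.injective spProj_spEmb))
  good := by
    intro u hu
    obtain ⟨v, hv, hx⟩ := c.good (spProj g F u) fun t => by rw [← sp_spEmb_left]; exact hu t
    obtain ⟨l, rfl⟩ := hρ.comp_left u
    refine ⟨spEmb g R v + (l - spEmb g R (spProj g R l)), ?_, fun s => ?_⟩
    · have h1 : ρ ∘ spEmb g R v = ρ ∘ spEmb g R (spProj g R l) := by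
        rw [comp_spEmb, comp_spEmb, hv]
        rfl
      ext k
      simp [show ρ (spEmb g R v k) = ρ (spEmb g R (spProj g R l) k) from congrFun h1 k]
    · rw [sp_spEmb_left, map_add, map_sub, spProj_spEmb, spProj_spEmb, sub_self, add_zero, hx]

/-- For large `g` every configuration can be moved into genus `g`, by moving a hyperbolic pair
orthogonal to it to the first pair of standard basis vectors. -/
theorem Config.exists_smul_eq_emb [Finite R] [Finite F] [IsLocalHom ρ]
    (hρ : Function.Surjective ρ) (h2 : (2 : F) ≠ 0) {Γ : Subgroup (GSp (g + 1) R)}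
    (hΓ : ∀ u c, spTransvection u c ∈ Γ) (c : Config ρ (g + 1) j d i)
    (hg : Nat.card R ^ (j + (d + i)) < Nat.card F ^ (g + 1)) :
    ∃ a : Γ, ∃ c' : Config ρ g j d i, a • c = c'.emb hρ := by
  choose l hl using fun t => hρ.comp_left (c.frame t)
  obtain ⟨a, b, ha, hb, hab⟩ := exists_hyperbolic_pair hρ (Sum.elim c.vecs l)
    (by rwa [Fintype.card_sum, Fintype.card_fin, Fintype.card_fin])
  obtain ⟨M, hM, hMa, hMb⟩ := exists_mulVec_eq_single ρ h2 hΓ hab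
  have key : ∀ v, sp (g + 1) R v a = 0 → sp (g + 1) R v b = 0 →
      (M.1.1 *ᵥ v) (Sum.inl 0) = 0 ∧ (M.1.1 *ᵥ v) (Sum.inr 0) = 0 := by
    intro v h1 h2
    rw [← GSp.sp_mulVec_eq_zero_iff M, hMa, sp_single_inl] at h1
    rw [← GSp.sp_mulVec_eq_zero_iff M, hMb, sp_single_inr, neg_eq_zero] at h2
    exact ⟨h2, h1⟩
  have hv : ∀ s, spEmb g R (spProj g R ((M • c).vecs s)) = (M • c).vecs s := fun s => by
    obtain ⟨h1, h2⟩ := key (c.vecs s) (ha (Sum.inl s)) (hb (Sum.inl s))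
    exact spEmb_spProj h1 h2
  have hw : ∀ t, spEmb g F (spProj g F ((M • c).frame t)) = (M • c).frame t := fun t => by
    obtain ⟨h1, h2⟩ := key (l t) (ha (Sum.inr t)) (hb (Sum.inr t))
    have h3 : (M • c).frame t = ρ ∘ (M.1.1 *ᵥ l t) := by
      rw [GSp.comp_mulVec, Config.smul_frame, ← hl]
    rw [h3]
    exact spEmb_spProj (by simp [h1]) (by simp [h2])
  refine ⟨⟨M, hM⟩, ⟨fun s => spProj g R ((M • c).vecs s), fun t => spProj g F ((M • c).frame t),
    ?_, ?_⟩, Config.ext (funext fun s => (hv s).symm) (funext fun t => (hw t).symm)⟩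
  · refine LinearIndependent.of_comp (spEmb g F) ?_
    convert (M • c).indep using 1
    exact funext hw
  · intro u hu
    obtain ⟨v, hv', hx⟩ := (M • c).good (spEmb g F u) fun t => by
      change sp (g + 1) F ((M • c).frame _) _ = 0
      rw [← hw, sp_spEmb_left, spProj_spEmb]
      exact hu t
    refine ⟨spProj g R v, ?_, fun s => ?_⟩
    · rw [← spProj_spEmb u, ← hv']
      rfl
    · rw [← sp_spEmb_left, hv]
      exact hx s

theorem card_orbits_config_genus_succ_le [Finite R] [Finite F] [IsLocalHom ρ]
    (hρ : Function.Surjective ρ) (h2 : (2 : F) ≠ 0) {Γ : ∀ g, Subgroup (GSp g R)}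
    (hΓ : IsStableFamily Γ) (hg : Nat.card R ^ (j + (d + i)) < Nat.card F ^ (g + 1)) :
    Nat.card (MulAction.orbitRel.Quotient (Γ (g + 1)) (Config ρ (g + 1) j d i)) ≤
      Nat.card (MulAction.orbitRel.Quotient (Γ g) (Config ρ g j d i)) := by
  let f : MulAction.orbitRel.Quotient (Γ g) (Config ρ g j d i) →
      MulAction.orbitRel.Quotient (Γ (g + 1)) (Config ρ (g + 1) j d i) :=
    Quotient.map' (Config.emb hρ) (by
      rintro _ c ⟨M, rfl⟩
      obtain ⟨M', hM', h⟩ := hΓ.extend g M.1 M.2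
      refine ⟨⟨M', hM'⟩, Config.ext (funext fun s => h _) (funext fun t => ?_)⟩
      change (GSp.map (g + 1) ρ M').1.1 *ᵥ spEmb g F (c.frame t) =
        spEmb g F ((GSp.map g ρ M.1).1.1 *ᵥ c.frame t)
      obtain ⟨l, hl⟩ := hρ.comp_left (c.frame t)
      rw [← hl, ← comp_spEmb, ← GSp.comp_mulVec, h, comp_spEmb, GSp.comp_mulVec])
  refine Nat.card_le_card_of_surjective f fun q => ?_
  induction q using Quotient.inductionOn' with | _ c
  obtain ⟨a, c', h⟩ := Config.exists_smul_eq_emb hρ h2 (hΓ.transvection_mem (g + 1)) c hg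
  exact ⟨Quotient.mk'' c', Quotient.sound' ⟨a, h⟩⟩

/-- From some genus on the number of orbits does not increase, hence it is eventually constant. -/
theorem exists_eventually_card_orbits_eq [Finite R] [Finite F] [IsLocalHom ρ]
    (hρ : Function.Surjective ρ) (h2 : (2 : F) ≠ 0) {Γ : ∀ g, Subgroup (GSp g R)}
    (hΓ : IsStableFamily Γ) (j d i : ℕ) :
    ∃ N : ℕ, ∀ᶠ g in atTop,
      Nat.card (MulAction.orbitRel.Quotient (Γ g) (Config ρ g j d i)) = N := by
  obtain ⟨g₀, hg₀⟩ := pow_unbounded_of_one_lt (Nat.card R ^ (j + (d + i)))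
    (Finite.one_lt_card (α := F))
  have hanti : Antitone fun g => Nat.card
      (MulAction.orbitRel.Quotient (Γ (g₀ + g)) (Config ρ (g₀ + g) j d i)) :=
    antitone_nat_of_succ_le fun g => card_orbits_config_genus_succ_le hρ h2 hΓ
      (hg₀.trans_le (Nat.pow_le_pow_right Nat.card_pos (Nat.le_add_right g₀ (g + 1))))
  obtain ⟨n, hn⟩ := WellFoundedLT.antitone_chain_condition hanti
  refine ⟨Nat.card (MulAction.orbitRel.Quotient (Γ (g₀ + n)) (Config ρ (g₀ + n) j d i)),
    eventually_atTop.2 ⟨g₀ + n, fun g hg => ?_⟩⟩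
  obtain ⟨k, rfl⟩ := Nat.exists_eq_add_of_le hg
  rw [add_assoc]
  exact (hn (n + k) (Nat.le_add_right _ _)).symm

end Stabilization

/-! ### Fixed vectors and fixed configurations -/

section FixedVectors

variable {R F : Type*} [CommRing R] [Field F] {ρ : R →+* F} {g j d i : ℕ}

/-- The vectors fixed by a similitude. -/
noncomputable def fixedVectors (M : GSp g R) : Submodule R (Fin g ⊕ Fin g → R) :=
  LinearMap.ker (Matrix.mulVecLin (M.1.1 - 1))

theorem mem_fixedVectors (M : GSp g R) (v : Fin g ⊕ Fin g → R) :
    v ∈ fixedVectors M ↔ M.1.1 *ᵥ v = v := by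
  rw [fixedVectors, LinearMap.mem_ker, mulVecLin_apply, sub_mulVec, one_mulVec, sub_eq_zero]

theorem redVec_sub_one_mulVec {S : Type*} [CommRing S] {ρ : R →+* S} (M : GSp g R)
    (v : Fin g ⊕ Fin g → R) :
    redVec g ρ ((M.1.1 - 1) *ᵥ v) = ((GSp.map g ρ M).1.1 - 1) *ᵥ redVec g ρ v := by
  rw [sub_mulVec, one_mulVec, map_sub, sub_mulVec, one_mulVec, redVec_apply, GSp.comp_mulVec]
  rfl

/-- A vector `u` over `F` orthogonal to the vectors fixed by the reduction of `M` lifts to a vector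
orthogonal to all vectors fixed by `M`. Indeed `u` is in the image of the adjoint of `M - 1`, and
any lift to the image of the adjoint over `R` will do. -/
theorem exists_lift_orthogonal_fixedVectors (hρ : Function.Surjective ρ) (M : GSp g R)
    (u : Fin g ⊕ Fin g → F) (hu : ∀ z ∈ fixedVectors (GSp.map g ρ M), sp g F z u = 0) :
    ∃ v, ρ ∘ v = u ∧ ∀ x ∈ fixedVectors M, sp g R x v = 0 := by
  have h1 : (sp g F).flip u ∈ (LinearMap.ker
      (Matrix.mulVecLin ((GSp.map g ρ M).1.1 - 1))).dualAnnihilator :=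
    (Submodule.mem_dualAnnihilator _).2 hu
  rw [← LinearMap.range_dualMap_eq_dualAnnihilator_ker] at h1
  obtain ⟨ψ, hψ⟩ := h1
  obtain ⟨e, he⟩ := exists_sp_eq_functional ψ
  obtain ⟨e, rfl⟩ := hρ.comp_left e
  obtain ⟨v, hv⟩ := exists_sp_eq_functional
    ((sp g R).flip e ∘ₗ Matrix.mulVecLin (M.1.1 - 1))
  refine ⟨v, ?_, fun x hx => ?_⟩
  · have h2 : ∀ z, sp g F z (ρ ∘ v) = sp g F z u := by
      intro z
      obtain ⟨x, rfl⟩ := redVec_surjective hρ z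
      have h3 : ψ (((GSp.map g ρ M).1.1 - 1) *ᵥ redVec g ρ x) = sp g F (redVec g ρ x) u :=
        LinearMap.congr_fun hψ _
      rw [← h3, ← he, ← redVec_sub_one_mulVec, redVec_apply, redVec_apply, ← map_sp, hv]
      exact map_sp ρ _ _
    rw [← sub_eq_zero]
    refine (sp_nondegenerate g F).2 _ fun z => ?_
    rw [map_sub, h2, sub_self]
  · rw [hv]
    change sp g R (Matrix.mulVecLin (M.1.1 - 1) x) e = 0
    rw [show Matrix.mulVecLin (M.1.1 - 1) x = 0 from hx, map_zero, LinearMap.zero_apply]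

theorem mem_fixedBy_config_iff (M : GSp g R) (c : Config ρ g j d i) :
    c ∈ MulAction.fixedBy (Config ρ g j d i) M ↔
      (∀ s, c.vecs s ∈ fixedVectors M) ∧ ∀ t, c.frame t ∈ fixedVectors (GSp.map g ρ M) := by
  simp only [MulAction.mem_fixedBy, mem_fixedVectors, Config.ext_iff, funext_iff]
  rfl

/-- A fixed configuration extends by any fixed vector outside the span of its frame, and this span
consists of fixed vectors. -/
theorem card_fixedBy_config_succ [Finite R] [Finite F] (M : GSp g R) :
    (Nat.card (MulAction.fixedBy (Config ρ g j d (i + 1)) M) : ℝ) =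
      Nat.card (MulAction.fixedBy (Config ρ g j d i) M) *
        ((Nat.card (fixedVectors (GSp.map g ρ M)) : ℝ) - (Nat.card F : ℝ) ^ (d + i)) := by
  classical
  set K := fixedVectors (GSp.map g ρ M) with hK
  let P : MulAction.fixedBy (Config ρ g j d i) M → (Fin g ⊕ Fin g → F) → Prop :=
    fun c z => z ∈ K ∧ z ∉ Submodule.span F (Set.range c.1.frame)
  let e : MulAction.fixedBy (Config ρ g j d (i + 1)) M →
      {p : MulAction.fixedBy (Config ρ g j d i) M × (Fin g ⊕ Fin g → F) // P p.1 p.2} :=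
    fun c => ⟨(⟨c.1.init, (mem_fixedBy_config_iff M _).2
        ⟨((mem_fixedBy_config_iff M _).1 c.2).1,
          fun t => ((mem_fixedBy_config_iff M _).1 c.2).2 _⟩⟩, c.1.frame (Fin.last _)),
      ((mem_fixedBy_config_iff M _).1 c.2).2 _, by
        have := c.1.indep
        rw [← Fin.snoc_init_self c.1.frame, linearIndependent_finSnoc] at this
        exact this.2⟩
  have he : Function.Bijective e := by
    constructor
    · intro c c' h
      have h1 := congrArg (fun p => p.1.1.1.vecs) h
      have h2 := congrArg (fun p => p.1.1.1.frame) h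
      have h3 := congrArg (fun p => p.1.2) h
      refine Subtype.ext (Config.ext h1 (funext fun t => ?_))
      induction t using Fin.lastCases with
      | last => exact h3
      | cast t => exact congrFun h2 t
    · rintro ⟨⟨⟨c, hc⟩, z⟩, hz, hz'⟩
      rw [mem_fixedBy_config_iff] at hc
      refine ⟨⟨⟨c.vecs, Fin.snoc (α := fun _ => Fin g ⊕ Fin g → F) c.frame z,
        linearIndependent_finSnoc.2 ⟨c.indep, hz'⟩, ?_⟩,
        (mem_fixedBy_config_iff M _).2 ⟨hc.1, fun t => ?_⟩⟩, ?_⟩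
      · convert c.good using 2 with t
        exact Fin.snoc_castSucc (α := fun _ => Fin g ⊕ Fin g → F) z c.frame (Fin.castAdd i t)
      · induction t using Fin.lastCases with
        | last => simpa using hz
        | cast t => simpa using hc.2 t
      · refine Subtype.ext (Prod.ext (Subtype.ext (Config.ext rfl (funext fun t => ?_))) ?_)
        · exact Fin.snoc_castSucc (α := fun _ => Fin g ⊕ Fin g → F) z c.frame t
        · exact Fin.snoc_last (α := fun _ => Fin g ⊕ Fin g → F) z c.frame
  have hfib : ∀ c, (Nat.card {z // P c z} : ℝ) =
      (Nat.card K : ℝ) - (Nat.card F : ℝ) ^ (d + i) := by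
    intro c
    have hle : Submodule.span F (Set.range c.1.frame) ≤ K := by
      rw [Submodule.span_le]
      rintro _ ⟨t, rfl⟩
      exact ((mem_fixedBy_config_iff M _).1 c.2).2 t
    have h1 : Nat.card (Submodule.span F (Set.range c.1.frame)) = Nat.card F ^ (d + i) := by
      rw [Module.natCard_eq_pow_finrank (K := F), finrank_span_eq_card c.1.indep, Fintype.card_fin]
    have h2 := Set.ncard_sdiff_add_ncard_of_subset
      (s := (Submodule.span F (Set.range c.1.frame) : Set (Fin g ⊕ Fin g → F)))
      (t := (K : Set (Fin g ⊕ Fin g → F))) hle (Set.toFinite _)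
    have h3 : Nat.card {z // P c z} =
      ((K : Set (Fin g ⊕ Fin g → F)) \
        (Submodule.span F (Set.range c.1.frame) : Set _)).ncard := rfl
    have h4 : (Submodule.span F (Set.range c.1.frame) : Set (Fin g ⊕ Fin g → F)).ncard =
      Nat.card F ^ (d + i) := h1
    have h5 : (K : Set (Fin g ⊕ Fin g → F)).ncard = Nat.card K := rfl
    rw [← h3, h4, h5] at h2
    rw [← h2]
    push_cast
    ring
  rw [Nat.card_congr ((Equiv.ofBijective e he).trans (Equiv.subtypeProdEquivSigmaSubtype P))]
  have := Fintype.ofFinite (MulAction.fixedBy (Config ρ g j d i) M)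
  rw [Nat.card_sigma, Nat.cast_sum, Finset.sum_congr rfl fun c _ => hfib c, Finset.sum_const,
    nsmul_eq_mul, Finset.card_univ,
    Nat.card_eq_fintype_card (α := MulAction.fixedBy (Config ρ g j d i) M)]

/-- If the fixed vectors over the residue field have dimension `d`, the condition imposed on
configurations holds for all fixed vectors. -/
theorem card_fixedBy_config_of_finrank_eq [Finite R] [Finite F] (hρ : Function.Surjective ρ)
    (M : GSp g R) (hd : Module.finrank F (fixedVectors (GSp.map g ρ M)) = d) :
    Nat.card (MulAction.fixedBy (Config ρ g j d 0) M) =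
      Nat.card (fixedVectors M) ^ j * ∏ t : Fin d, (Nat.card F ^ d - Nat.card F ^ t.1) := by
  set K := fixedVectors (GSp.map g ρ M) with hK
  have := Fintype.ofFinite F
  have h1 := card_linearIndependent (K := F) (V := K) (k := d) hd.ge
  rw [hd, ← Nat.card_eq_fintype_card] at h1
  have h2 : Nat.card (Fin j → fixedVectors M) = Nat.card (fixedVectors M) ^ j := by
    rw [Nat.card_fun, Nat.card_fin]
  rw [← h1, ← h2, ← Nat.card_prod]
  let e : MulAction.fixedBy (Config ρ g j d 0) M →
      (Fin j → fixedVectors M) × {s : Fin d → K // LinearIndependent F s} :=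
    fun c => (fun s => ⟨c.1.vecs s, ((mem_fixedBy_config_iff M _).1 c.2).1 s⟩,
      ⟨fun t => ⟨c.1.frame t, ((mem_fixedBy_config_iff M _).1 c.2).2 t⟩,
        LinearIndependent.of_comp K.subtype c.1.indep⟩)
  refine Nat.card_congr (Equiv.ofBijective e ⟨fun c c' h => ?_, ?_⟩)
  · refine Subtype.ext (Config.ext (funext fun s => ?_) (funext fun t => ?_))
    · exact congrArg (fun p => (p.1 s).1) h
    · exact congrArg (fun p => (p.2.1 t).1) h
  · rintro ⟨x, w, hw⟩
    refine ⟨⟨⟨fun s => (x s).1, fun t => (w t).1, hw.map' K.subtype K.ker_subtype, ?_⟩,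
      (mem_fixedBy_config_iff M _).2 ⟨fun s => (x s).2, fun t => (w t).2⟩⟩, rfl⟩
    intro u hu
    obtain ⟨v, hv, hx⟩ := exists_lift_orthogonal_fixedVectors hρ M u fun z hz => by
      have htop : Submodule.span F (Set.range w) = ⊤ :=
        hw.span_eq_top_of_card_eq_finrank' (by rw [Fintype.card_fin, hd])
      have hle : Submodule.span F (Set.range w) ≤
          LinearMap.ker ((sp g F).flip u ∘ₗ K.subtype) := by
        rw [Submodule.span_le]
        rintro _ ⟨t, rfl⟩
        exact hu t
      exact hle (htop ▸ Submodule.mem_top : (⟨z, hz⟩ : K) ∈ _)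
    exact ⟨v, hv, fun s => hx _ (x s).2⟩

theorem card_fixedBy_config_of_finrank_lt [Finite R] [Finite F] (M : GSp g R)
    (hd : Module.finrank F (fixedVectors (GSp.map g ρ M)) < d) :
    Nat.card (MulAction.fixedBy (Config ρ g j d i) M) = 0 := by
  have : IsEmpty (MulAction.fixedBy (Config ρ g j d i) M) := by
    refine ⟨fun c => ?_⟩
    have hc := ((mem_fixedBy_config_iff M _).1 c.2).2
    have h1 : LinearIndependent F fun t => (⟨c.1.frame t, hc t⟩ : fixedVectors (GSp.map g ρ M)) :=
      LinearIndependent.of_comp (Submodule.subtype _) c.1.indep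
    have := h1.fintype_card_le_finrank
    rw [Fintype.card_fin] at this
    omega
  exact Nat.card_of_isEmpty

/-! ### Comparing the fixed vectors over `R` and over the residue field -/

theorem card_quotient_range_eq_card_ker {V : Type*} [AddCommGroup V] [Module R V] [Finite V]
    (f : V →ₗ[R] V) : Nat.card (V ⧸ LinearMap.range f) = Nat.card (LinearMap.ker f) := by
  have h1 := Submodule.card_eq_card_quotient_mul_card (LinearMap.ker f)
  have h2 := Submodule.card_eq_card_quotient_mul_card (LinearMap.range f)
  rw [Nat.card_congr f.quotKerEquivRange.toEquiv, h2, mul_comm] at h1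
  exact Nat.eq_of_mul_eq_mul_right (Nat.card_pos (α := LinearMap.range f)) (by linarith)

theorem card_fixedVectors_map_le [Finite R] [Finite F] (hρ : Function.Surjective ρ) (M : GSp g R) :
    Nat.card (fixedVectors (GSp.map g ρ M)) ≤ Nat.card (fixedVectors M) := by
  rw [fixedVectors, fixedVectors, ← card_quotient_range_eq_card_ker,
    ← card_quotient_range_eq_card_ker]
  have h : LinearMap.range (Matrix.mulVecLin (M.1.1 - 1)) ≤
      (LinearMap.range (Matrix.mulVecLin ((GSp.map g ρ M).1.1 - 1))).comap (redVec g ρ) := by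
    rintro _ ⟨v, rfl⟩
    exact ⟨redVec g ρ v, (redVec_sub_one_mulVec M v).symm⟩
  have := Finite.of_surjective _
    (Submodule.mkQ_surjective (LinearMap.range (Matrix.mulVecLin (M.1.1 - 1))))
  refine Nat.card_le_card_of_surjective (Submodule.mapQ _ _ (redVec g ρ) h) fun q => ?_
  obtain ⟨w, rfl⟩ := Submodule.mkQ_surjective _ q
  obtain ⟨v, rfl⟩ := redVec_surjective hρ w
  exact ⟨Submodule.mkQ _ v, rfl⟩

/-- By Nakayama's lemma the cokernel of `M - 1` is generated by lifts of the elements of its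
reduction, so it is bounded in terms of the number of fixed vectors over the residue field. -/
theorem card_fixedVectors_le [Finite R] [Finite F] [IsLocalHom ρ] (hρ : Function.Surjective ρ)
    (M : GSp g R) :
    Nat.card (fixedVectors M) ≤ Nat.card R ^ Nat.card (fixedVectors (GSp.map g ρ M)) := by
  rw [fixedVectors, fixedVectors, ← card_quotient_range_eq_card_ker,
    ← card_quotient_range_eq_card_ker]
  set N := Matrix.mulVecLin (M.1.1 - 1)
  set N' := Matrix.mulVecLin ((GSp.map g ρ M).1.1 - 1) with hN'
  have hsurj : Function.Surjective fun v => (LinearMap.range N').mkQ (redVec g ρ v) :=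
    (Submodule.mkQ_surjective _).comp (redVec_surjective hρ)
  choose r hr using hsurj
  have htop : (⊤ : Submodule R (Fin g ⊕ Fin g → R)) ≤
      LinearMap.range N ⊔ Submodule.span R (Set.range r) := by
    refine Submodule.le_of_le_smul_of_le_jacobson_bot (I := RingHom.ker ρ)
      Module.Finite.fg_top ?_ ?_
    · intro a ha
      rw [Ideal.mem_jacobson_bot]
      refine fun b => isUnit_of_map_unit ρ _ ?_
      rw [map_add, map_mul, (RingHom.mem_ker).1 ha, zero_mul, zero_add, map_one]
      exact isUnit_one
    · intro v _
      have h1 : redVec g ρ v - redVec g ρ (r ((LinearMap.range N').mkQ (redVec g ρ v))) ∈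
          LinearMap.range N' := by
        rw [← Submodule.Quotient.mk_eq_zero, Submodule.Quotient.mk_sub, sub_eq_zero]
        exact (hr _).symm
      obtain ⟨w, hw⟩ := h1
      obtain ⟨w, rfl⟩ := redVec_surjective hρ w
      set y := r ((LinearMap.range N').mkQ (redVec g ρ v))
      have h2 : redVec g ρ (v - y - N w) = 0 := by
        rw [map_sub, map_sub, ← hw]
        exact sub_eq_zero.2 (redVec_sub_one_mulVec M w).symm
      have h3 : v - y - N w ∈ RingHom.ker ρ • (⊤ : Submodule R (Fin g ⊕ Fin g → R)) := by
        rw [pi_eq_sum_univ' (v - y - N w)]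
        exact Submodule.sum_mem _ fun k _ =>
          Submodule.smul_mem_smul ((RingHom.mem_ker).2 (congrFun h2 k)) trivial
      rw [show v = (N w + y) + (v - y - N w) by abel]
      exact Submodule.add_mem_sup
        (Submodule.add_mem_sup ⟨w, rfl⟩ (Submodule.subset_span ⟨_, rfl⟩)) h3
  have := Finite.of_surjective _ (Submodule.mkQ_surjective (LinearMap.range N'))
  have := Fintype.ofFinite ((Fin g ⊕ Fin g → F) ⧸ LinearMap.range N')
  rw [← Nat.card_fun]
  refine Nat.card_le_card_of_surjective
    ((LinearMap.range N).mkQ ∘ₗ Fintype.linearCombination R r) ?_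
  rw [← LinearMap.range_eq_top, LinearMap.range_comp, Fintype.range_linearCombination]
  rw [top_le_iff] at htop
  have := congrArg (Submodule.map (LinearMap.range N).mkQ) htop
  rwa [Submodule.map_sup, Submodule.mkQ_map_self, bot_sup_eq, Submodule.map_top,
    Submodule.range_mkQ] at this

end FixedVectors

/-! ### Averages over finite groups -/

section Mean

variable {G : Type*} [Finite G]

/-- The average of a function on a finite group. -/
noncomputable def groupMean (G : Type*) [Finite G] (f : G → ℝ) : ℝ :=
  letI := Fintype.ofFinite G
  (∑ a, f a) / Nat.card G

theorem groupMean_sum {κ : Type*} (s : Finset κ) (c : κ → ℝ) (f : κ → G → ℝ) :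
    groupMean G (fun a => ∑ k ∈ s, c k * f k a) = ∑ k ∈ s, c k * groupMean G (f k) := by
  simp only [groupMean, Finset.sum_div, Finset.mul_sum]
  rw [Finset.sum_comm]
  simp only [mul_div_assoc]

theorem groupMean_mul_const (f : G → ℝ) (c : ℝ) :
    groupMean G (fun a => f a * c) = groupMean G f * c := by
  rw [groupMean, groupMean, ← Finset.sum_mul, mul_div_right_comm]

theorem groupMean_const [Nonempty G] (c : ℝ) : groupMean G (fun _ => c) = c := by
  let _ := Fintype.ofFinite G
  have : (Nat.card G : ℝ) ≠ 0 := Nat.cast_ne_zero.2 Nat.card_pos.ne'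
  rw [groupMean, Finset.sum_const, nsmul_eq_mul, Finset.card_univ, ← Nat.card_eq_fintype_card,
    mul_div_cancel_left₀ _ this]

theorem abs_groupMean_sub_le {f h k : G → ℝ} (H : ∀ a, |f a - h a| ≤ k a) :
    |groupMean G f - groupMean G h| ≤ groupMean G k := by
  let _ := Fintype.ofFinite G
  rw [groupMean, groupMean, groupMean, ← sub_div, ← Finset.sum_sub_distrib, abs_div, Nat.abs_cast]
  gcongr
  exact (Finset.abs_sum_le_sum_abs _ _).trans (Finset.sum_le_sum fun a _ => H a)

/-- The Cauchy–Frobenius lemma. -/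
theorem groupMean_card_fixedBy [Group G] (X : Type*) [MulAction G X] [Finite X] :
    groupMean G (fun a => (Nat.card (MulAction.fixedBy X a) : ℝ)) =
      Nat.card (MulAction.orbitRel.Quotient G X) := by
  classical
  let _ := Fintype.ofFinite G
  have := Fintype.ofFinite X
  have := Fintype.ofFinite (MulAction.orbitRel.Quotient G X)
  have h : (Nat.card G : ℝ) ≠ 0 := Nat.cast_ne_zero.2 Nat.card_pos.ne'
  have h1 := MulAction.sum_card_fixedBy_eq_card_orbits_mul_card_group G X
  simp only [← Nat.card_eq_fintype_card] at h1
  rw [groupMean, div_eq_iff h, ← Nat.cast_sum, h1, Nat.cast_mul]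

end Mean

/-! ### Truncated inclusion–exclusion over subspaces -/

theorem sum_range_neg_one_pow_mul_prod (q Q : ℝ) (hq : 1 < q) (N : ℕ) :
    ∑ i ∈ Finset.range (N + 1),
      (-1) ^ i * ((∏ t ∈ Finset.range i, (Q - q ^ t)) / ∏ s ∈ Finset.range i, (q ^ (s + 1) - 1)) =
    (-1) ^ N * ((∏ t ∈ Finset.range N, (Q - q ^ (t + 1))) /
      ∏ s ∈ Finset.range N, (q ^ (s + 1) - 1)) := by
  have hpos : ∀ n, (∏ s ∈ Finset.range n, (q ^ (s + 1) - 1)) ≠ 0 := fun n =>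
    Finset.prod_ne_zero_iff.2 fun s _ => (sub_pos.2 (one_lt_pow₀ hq s.succ_ne_zero)).ne'
  induction N with
  | zero => simp
  | succ N ih =>
    have h1 := hpos N
    have h2 : q ^ (N + 1) - 1 ≠ 0 := (sub_pos.2 (one_lt_pow₀ hq N.succ_ne_zero)).ne'
    rw [Finset.sum_range_succ, ih, Finset.prod_range_succ' (fun t => Q - q ^ t) N,
      Finset.prod_range_succ _ N, Finset.prod_range_succ _ N]
    field_simp
    ring

/-- The truncations of the inclusion–exclusion formula for the indicator of `D = 0` as a sum over
the linearly independent tuples in a space of dimension `D`. The error is at most the last term. -/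
theorem abs_sum_range_sub_indicator_le (q : ℝ) (hq : 1 < q) (D N : ℕ) :
    |∑ i ∈ Finset.range (N + 1), (-1) ^ i *
        ((∏ t ∈ Finset.range i, (q ^ D - q ^ t)) / ∏ s ∈ Finset.range i, (q ^ (s + 1) - 1)) -
      (if D = 0 then 1 else 0)| ≤
    (∏ t ∈ Finset.range N, (q ^ D - q ^ t)) / ∏ s ∈ Finset.range N, (q ^ (s + 1) - 1) := by
  have hpos : ∀ n, 0 < ∏ s ∈ Finset.range n, (q ^ (s + 1) - 1) := fun n =>
    Finset.prod_pos fun s _ => sub_pos.2 (one_lt_pow₀ hq s.succ_ne_zero)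
  have hnn : ∀ n, 0 ≤ ∏ t ∈ Finset.range n, (q ^ D - q ^ t) := by
    intro n
    rcases le_or_gt n D with h | h
    · exact Finset.prod_nonneg fun t ht => sub_nonneg.2
        (pow_le_pow_right₀ hq.le ((Finset.mem_range.1 ht).le.trans h))
    · rw [Finset.prod_eq_zero (Finset.mem_range.2 h) (sub_self _)]
  rw [sum_range_neg_one_pow_mul_prod q _ hq]
  split_ifs with hD
  · subst hD
    have h1 : ∏ t ∈ Finset.range N, (q ^ 0 - q ^ (t + 1)) =
        (-1) ^ N * ∏ s ∈ Finset.range N, (q ^ (s + 1) - 1) := by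
      rw [← Finset.card_range N, ← Finset.prod_const, Finset.card_range, ← Finset.prod_mul_distrib]
      exact Finset.prod_congr rfl fun s _ => by ring
    rw [h1, mul_div_assoc, div_self (hpos N).ne', mul_one, ← pow_add, Even.neg_one_pow ⟨N, rfl⟩,
      sub_self, abs_zero]
    exact div_nonneg (hnn N) (hpos N).le
  · rw [sub_zero, abs_mul, abs_neg_one_pow, one_mul, abs_div, abs_of_pos (hpos N)]
    refine div_le_div_of_nonneg_right ?_ (hpos N).le
    rcases le_or_gt D N with h | h
    · rw [Finset.prod_eq_zero (Finset.mem_range.2 (by omega : D - 1 < N))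
        (by rw [Nat.sub_add_cancel (Nat.pos_of_ne_zero hD), sub_self]), abs_zero]
      exact hnn N
    · rw [Finset.abs_prod]
      refine Finset.prod_le_prod (fun t _ => abs_nonneg _) fun t ht => ?_
      rw [abs_of_nonneg (sub_nonneg.2 (pow_le_pow_right₀ hq.le
        (by have := Finset.mem_range.1 ht; omega)))]
      exact sub_le_sub_left (pow_le_pow_right₀ hq.le t.le_succ) _

/-! ### Limits of averages in the genus -/

/-- A sequence that is uniformly approximated by convergent sequences converges. -/
theorem exists_tendsto_of_forall_approx {u : ℕ → ℝ}
    (h : ∀ ε > 0, ∃ v : ℕ → ℝ, (∃ l, Tendsto v atTop (𝓝 l)) ∧ ∀ᶠ n in atTop, |u n - v n| ≤ ε) :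
    ∃ l, Tendsto u atTop (𝓝 l) := by
  refine cauchySeq_tendsto_of_complete (Metric.cauchySeq_iff'.2 fun ε hε => ?_)
  obtain ⟨v, ⟨l, hl⟩, hv⟩ := h (ε / 5) (by positivity)
  have h1 := Metric.tendsto_nhds.1 hl (ε / 5) (by positivity)
  obtain ⟨N, hN⟩ := eventually_atTop.1 (h1.and hv)
  refine ⟨N, fun n hn => ?_⟩
  obtain ⟨a1, a2⟩ := hN n hn
  obtain ⟨b1, b2⟩ := hN N le_rfl
  rw [Real.dist_eq] at a1 b1 ⊢
  rw [abs_lt] at *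
  rw [abs_le] at a2 b2
  constructor <;> linarith [a1.1, a1.2, b1.1, b1.2, a2.1, a2.2, b2.1, b2.2]

section Limits

variable {R F : Type*} [CommRing R] [Field F] [Finite R] [Finite F] {ρ : R →+* F}

/-- The number `q^{di} ∏_{s = 1}^i (q^s - 1)` by which the number of extensions of a `d`-frame by
`i` vectors is divided in the inclusion–exclusion formula. The factor `q^{di}` accounts for passing
to the quotient by the span of the `d`-frame; the product is the order `q^{i(i-1)/2} ∏ (q^s - 1)` of
`GL_i(F)` divided by the absolute value `q^{i(i-1)/2}` of the Möbius function. -/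
noncomputable def frameFactor (q : ℝ) (d i : ℕ) : ℝ :=
  q ^ (d * i) * ∏ s ∈ Finset.range i, (q ^ (s + 1) - 1)

theorem frameFactor_pos {q : ℝ} (hq : 1 < q) (d i : ℕ) : 0 < frameFactor q d i :=
  mul_pos (by positivity) (Finset.prod_pos fun s _ => sub_pos.2 (one_lt_pow₀ hq s.succ_ne_zero))

theorem card_fixedBy_config_div_frameFactor {g j d : ℕ} (M : GSp g R) (i : ℕ) :
    (Nat.card (MulAction.fixedBy (Config ρ g j d i) M) : ℝ) / frameFactor (Nat.card F) d i =
      Nat.card (MulAction.fixedBy (Config ρ g j d 0) M) *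
        ((∏ t ∈ Finset.range i, ((Nat.card (fixedVectors (GSp.map g ρ M)) : ℝ) /
          (Nat.card F : ℝ) ^ d - (Nat.card F : ℝ) ^ t)) /
        ∏ s ∈ Finset.range i, ((Nat.card F : ℝ) ^ (s + 1) - 1)) := by
  have hq : (1 : ℝ) < Nat.card F := Nat.one_lt_cast.2 Finite.one_lt_card
  induction i with
  | zero => simp [frameFactor]
  | succ i ih =>
    have h1 : (Nat.card F : ℝ) ^ (i + 1) - 1 ≠ 0 :=
      (sub_pos.2 (one_lt_pow₀ hq i.succ_ne_zero)).ne'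
    have h2 : frameFactor (Nat.card F) d (i + 1) =
        frameFactor (Nat.card F) d i *
          ((Nat.card F : ℝ) ^ d * ((Nat.card F : ℝ) ^ (i + 1) - 1)) := by
      rw [frameFactor, frameFactor, Finset.prod_range_succ]
      ring
    have h3 : ((Nat.card (fixedVectors (GSp.map g ρ M)) : ℝ) - (Nat.card F : ℝ) ^ (d + i)) /
        (Nat.card F : ℝ) ^ d = (Nat.card (fixedVectors (GSp.map g ρ M)) : ℝ) /
          (Nat.card F : ℝ) ^ d - (Nat.card F : ℝ) ^ i := by
      rw [sub_div, pow_add, mul_div_cancel_left₀ _ (by positivity)]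
    rw [card_fixedBy_config_succ, h2, mul_div_mul_comm, ih, ← div_div, h3, Finset.prod_range_succ,
      Finset.prod_range_succ, mul_assoc, div_mul_div_comm]

open Classical in
/-- Truncated inclusion–exclusion for the number of fixed configurations whose frame spans the
fixed vectors over the residue field. -/
theorem abs_sum_card_fixedBy_config_sub_le (hρ : Function.Surjective ρ) {g : ℕ} (j d N : ℕ)
    (M : GSp g R) :
    |∑ i ∈ Finset.range (N + 1), ((-1) ^ i / frameFactor (Nat.card F) d i) *
        (Nat.card (MulAction.fixedBy (Config ρ g j d i) M) : ℝ) -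
      (if Module.finrank F (fixedVectors (GSp.map g ρ M)) = d then 1 else 0) *
        (Nat.card (fixedVectors M) : ℝ) ^ j *
        ((∏ t : Fin d, (Nat.card F ^ d - Nat.card F ^ t.1) : ℕ) : ℝ)| ≤
    (1 / frameFactor (Nat.card F) d N) *
      (Nat.card (MulAction.fixedBy (Config ρ g j d N) M) : ℝ) := by
  have hq : (1 : ℝ) < Nat.card F := Nat.one_lt_cast.2 Finite.one_lt_card
  have hterm : ∀ i, ((-1) ^ i / frameFactor (Nat.card F) d i) *
      (Nat.card (MulAction.fixedBy (Config ρ g j d i) M) : ℝ) =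
      (-1) ^ i * ((Nat.card (MulAction.fixedBy (Config ρ g j d i) M) : ℝ) /
        frameFactor (Nat.card F) d i) := fun i => by ring
  simp only [hterm]
  rw [one_div_mul_eq_div]
  rcases lt_or_ge (Module.finrank F (fixedVectors (GSp.map g ρ M))) d with h | h
  · simp only [card_fixedBy_config_of_finrank_lt M h, if_neg h.ne]
    simp
  · obtain ⟨D, hD⟩ := Nat.exists_eq_add_of_le h
    have hQ : (Nat.card (fixedVectors (GSp.map g ρ M)) : ℝ) / (Nat.card F : ℝ) ^ d =
        (Nat.card F : ℝ) ^ D := by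
      rw [Module.natCard_eq_pow_finrank (K := F), hD, Nat.cast_pow, pow_add,
        mul_div_cancel_left₀ _ (by positivity)]
    have hind : (if Module.finrank F (fixedVectors (GSp.map g ρ M)) = d then 1 else 0) *
        (Nat.card (fixedVectors M) : ℝ) ^ j *
        ((∏ t : Fin d, (Nat.card F ^ d - Nat.card F ^ t.1) : ℕ) : ℝ) =
        Nat.card (MulAction.fixedBy (Config ρ g j d 0) M) * (if D = 0 then 1 else 0) := by
      by_cases hD0 : D = 0
      · rw [if_pos (by omega), if_pos hD0,
          card_fixedBy_config_of_finrank_eq hρ M (by omega)]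
        push_cast
        ring
      · rw [if_neg (by omega), if_neg hD0]
        ring
    have hterm' : ∀ (i : ℕ) (a b : ℝ), (-1) ^ i * (a * b) = a * ((-1) ^ i * b) := fun i a b => by
      ring
    simp only [card_fixedBy_config_div_frameFactor M, hQ, hind, hterm']
    rw [← Finset.mul_sum, ← mul_sub, abs_mul, Nat.abs_cast]
    exact mul_le_mul_of_nonneg_left (abs_sum_range_sub_indicator_le _ hq D N) (Nat.cast_nonneg _)

/-- The normalized number of orbits of configurations decays exponentially in the number of
additional vectors of the frame: adding a vector multiplies it by at most
`q^{d + N} / (q^d (q^{N + 1} - 1)) ≤ 1 / 2`. -/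
theorem card_orbits_config_div_le (hρ : Function.Surjective ρ) (h2 : (2 : F) ≠ 0) {g : ℕ}
    {Γ : Subgroup (GSp g R)} (hΓ : ∀ u c, spTransvection u c ∈ Γ) (j d N : ℕ) :
    (Nat.card (MulAction.orbitRel.Quotient Γ (Config ρ g j d N)) : ℝ) /
        frameFactor (Nat.card F) d N ≤
      Nat.card (MulAction.orbitRel.Quotient Γ (Config ρ g j d 0)) * (1 / 2) ^ N := by
  have hq : (1 : ℝ) < Nat.card F := Nat.one_lt_cast.2 Finite.one_lt_card
  have hq3 : (3 : ℝ) ≤ Nat.card F := by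
    have h1 : Nat.card F ≠ 2 := fun h => h2 <| by
      have := Fintype.ofFinite F
      have h3 := Nat.cast_card_eq_zero F
      rw [← Nat.card_eq_fintype_card, h] at h3
      exact_mod_cast h3
    have := Finite.one_lt_card (α := F)
    exact_mod_cast (by omega : 3 ≤ Nat.card F)
  induction N with
  | zero => simp [frameFactor]
  | succ N ih =>
    have h1 := card_orbits_config_succ_le (ρ := ρ) (j := j) (d := d) (i := N) hρ h2 hΓ
    set o := fun n => (Nat.card (MulAction.orbitRel.Quotient Γ (Config ρ g j d n)) : ℝ)
    set q : ℝ := (Nat.card F : ℝ)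
    have h3 : o (N + 1) ≤ o N * q ^ (d + N) := by
      have := Nat.cast_le (α := ℝ).2 h1
      push_cast at this
      exact this
    have h4 : frameFactor q d (N + 1) = frameFactor q d N * (q ^ d * (q ^ (N + 1) - 1)) := by
      rw [frameFactor, frameFactor, Finset.prod_range_succ]
      ring
    have h5 : q ^ (d + N) ≤ 1 / 2 * (q ^ d * (q ^ (N + 1) - 1)) := by
      have h6 : 2 * q ^ N ≤ q ^ (N + 1) - 1 := by
        have := one_le_pow₀ hq.le (n := N)
        rw [pow_succ]
        nlinarith
      have h7 : 0 < q ^ d := by positivity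
      rw [pow_add]
      nlinarith
    have hf := frameFactor_pos hq d N
    have ho : 0 ≤ o N := Nat.cast_nonneg _
    change o (N + 1) / frameFactor q d (N + 1) ≤ o 0 * (1 / 2) ^ (N + 1)
    rw [div_le_iff₀ (frameFactor_pos hq d _), h4]
    have ih' : o N ≤ o 0 * (1 / 2) ^ N * frameFactor q d N := (div_le_iff₀ hf).1 ih
    calc o (N + 1) ≤ o N * q ^ (d + N) := h3
      _ ≤ o N * (1 / 2 * (q ^ d * (q ^ (N + 1) - 1))) := mul_le_mul_of_nonneg_left h5 ho
      _ ≤ (o 0 * (1 / 2) ^ N * frameFactor q d N) * (1 / 2 * (q ^ d * (q ^ (N + 1) - 1))) := by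
        refine mul_le_mul_of_nonneg_right ih' (le_trans ?_ h5)
        positivity
      _ = _ := by ring

open Classical in
/-- By the Cauchy–Frobenius lemma, averaging the truncated inclusion–exclusion formula gives a
combination of numbers of orbits, which are eventually constant in `g`, with an error that is
small uniformly in `g`. -/
theorem exists_tendsto_groupMean_indicator_mul_pow [IsLocalHom ρ] (hρ : Function.Surjective ρ)
    (h2 : (2 : F) ≠ 0) {Γ : ∀ g, Subgroup (GSp g R)} (hΓ : IsStableFamily Γ) (j d : ℕ) :
    ∃ L, Tendsto (fun g => groupMean (Γ g) fun M =>
      (if Module.finrank F (fixedVectors (GSp.map g ρ M.1)) = d then 1 else 0) *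
        (Nat.card (fixedVectors M.1) : ℝ) ^ j) atTop (𝓝 L) := by
  have hq : (1 : ℝ) < Nat.card F := Nat.one_lt_cast.2 Finite.one_lt_card
  set n : ℝ := ((∏ t : Fin d, (Nat.card F ^ d - Nat.card F ^ t.1) : ℕ) : ℝ) with hn
  have hn0 : n ≠ 0 := by
    rw [hn, Nat.cast_ne_zero, Finset.prod_ne_zero_iff]
    exact fun t _ => (Nat.sub_pos_of_lt (Nat.pow_lt_pow_right Finite.one_lt_card t.2)).ne'
  suffices h : ∃ L, Tendsto (fun g => groupMean (Γ g) (fun M =>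
      (if Module.finrank F (fixedVectors (GSp.map g ρ M.1)) = d then 1 else 0) *
        (Nat.card (fixedVectors M.1) : ℝ) ^ j) * n) atTop (𝓝 L) by
    obtain ⟨L, hL⟩ := h
    refine ⟨L / n, ?_⟩
    have := hL.div_const n
    simpa only [mul_div_cancel_right₀ _ hn0] using this
  choose o ho using exists_eventually_card_orbits_eq hρ h2 hΓ j d
  refine exists_tendsto_of_forall_approx fun ε hε => ?_
  obtain ⟨N, hN⟩ : ∃ N : ℕ, (o 0 : ℝ) * (1 / 2) ^ N < ε := by
    have h1 : Tendsto (fun N : ℕ => (o 0 : ℝ) * (1 / 2) ^ N) atTop (𝓝 (o 0 * 0)) :=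
      (tendsto_pow_atTop_nhds_zero_of_lt_one (by norm_num) (by norm_num)).const_mul _
    rw [mul_zero] at h1
    exact (h1.eventually (gt_mem_nhds hε)).exists
  refine ⟨fun g => ∑ i ∈ Finset.range (N + 1), ((-1) ^ i / frameFactor (Nat.card F) d i) *
    (Nat.card (MulAction.orbitRel.Quotient (Γ g) (Config ρ g j d i)) : ℝ),
    ⟨_, tendsto_finsetSum _ fun i _ =>
      (tendsto_const_nhds (x := (o i : ℝ))).congr' ?_ |>.const_mul _⟩,
    ?_⟩
  · filter_upwards [ho i] with g hg
    rw [hg]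
  · filter_upwards [ho 0] with g hg
    rw [abs_sub_comm, ← groupMean_mul_const]
    simp only [← groupMean_card_fixedBy]
    rw [← groupMean_sum]
    refine (abs_groupMean_sub_le fun M : Γ g =>
      abs_sum_card_fixedBy_config_sub_le hρ j d N M.1).trans ?_
    have h1 := card_orbits_config_div_le hρ h2 (hΓ.transvection_mem g) j d N
    rw [hg, ← groupMean_card_fixedBy, ← one_div_mul_eq_div, mul_comm, ← groupMean_mul_const] at h1
    simp only [mul_comm (1 / frameFactor _ _ _)]
    exact h1.trans hN.le

/-- There is a real polynomial that takes the value `1 / a` at each `a ∈ {1, …, B}`. -/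
theorem exists_polynomial_eval_eq_one_div (B : ℕ) :
    ∃ P : Polynomial ℝ, ∀ a : ℕ, 1 ≤ a → a ≤ B → P.eval (a : ℝ) = 1 / a := by
  refine ⟨Lagrange.interpolate (Finset.Icc 1 B) (fun a : ℕ => (a : ℝ)) fun a => 1 / (a : ℝ),
    fun a h1 h2 => ?_⟩
  exact Lagrange.eval_interpolate_at_node _ (fun _ _ _ _ h => Nat.cast_injective h)
    (Finset.mem_Icc.2 ⟨h1, h2⟩)

/-- Elements with many fixed vectors contribute little; on the others `1 / |K|` is a polynomial in
the number `|K|` of fixed vectors, whose powers are covered by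
`exists_tendsto_groupMean_indicator_mul_pow`. -/
theorem exists_tendsto_groupMean_one_div [IsLocalHom ρ] (hρ : Function.Surjective ρ)
    (h2 : (2 : F) ≠ 0) {Γ : ∀ g, Subgroup (GSp g R)} (hΓ : IsStableFamily Γ) :
    ∃ L, Tendsto (fun g => groupMean (Γ g) fun M => 1 / (Nat.card (fixedVectors M.1) : ℝ))
      atTop (𝓝 L) := by
  classical
  have hq : (1 : ℝ) < Nat.card F := Nat.one_lt_cast.2 Finite.one_lt_card
  refine exists_tendsto_of_forall_approx fun ε hε => ?_
  obtain ⟨D, hD⟩ : ∃ D : ℕ, (1 / (Nat.card F : ℝ)) ^ D < ε :=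
    exists_pow_lt_of_lt_one hε (by rw [div_lt_one (by positivity)]; exact hq)
  obtain ⟨P, hP⟩ := exists_polynomial_eval_eq_one_div (Nat.card R ^ (Nat.card F ^ D))
  choose L hL using fun d j => exists_tendsto_groupMean_indicator_mul_pow hρ h2 hΓ j d
  let s := Finset.range (D + 1) ×ˢ Finset.range (P.natDegree + 1)
  let f : ∀ g, ℕ × ℕ → Γ g → ℝ := fun g p M =>
    (if Module.finrank F (fixedVectors (GSp.map g ρ M.1)) = p.1 then 1 else 0) *
      (Nat.card (fixedVectors M.1) : ℝ) ^ p.2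
  refine ⟨fun g => ∑ p ∈ s, P.coeff p.2 * groupMean (Γ g) (f g p),
    ⟨_, tendsto_finsetSum _ fun p _ => (hL p.1 p.2).const_mul _⟩, Eventually.of_forall fun g => ?_⟩
  change |_ - ∑ p ∈ s, P.coeff p.2 * groupMean (Γ g) (f g p)| ≤ ε
  rw [← groupMean_sum]
  refine (abs_groupMean_sub_le (k := fun _ => ε) fun M => ?_).trans (groupMean_const ε).le
  have hsum : ∑ p ∈ s, P.coeff p.2 * f g p M =
      if Module.finrank F (fixedVectors (GSp.map g ρ M.1)) ≤ D then
        P.eval (Nat.card (fixedVectors M.1) : ℝ) else 0 := by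
    rw [Finset.sum_product, Polynomial.eval_eq_sum_range]
    rw [Finset.sum_comm]
    simp only [f, ite_mul, one_mul, zero_mul, mul_ite, mul_zero, Finset.sum_ite_eq,
      Finset.mem_range, Nat.lt_succ_iff]
    split_ifs
    · rfl
    · exact Finset.sum_const_zero
  rw [hsum]
  have hcard := Module.natCard_eq_pow_finrank (K := F) (V := fixedVectors (GSp.map g ρ M.1))
  split_ifs with h
  · rw [hP _ Nat.card_pos ((card_fixedVectors_le hρ M.1).trans (Nat.pow_le_pow_right Nat.card_pos
      (by rw [hcard]; exact Nat.pow_le_pow_right Nat.card_pos h))), sub_self, abs_zero]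
    exact hε.le
  · rw [sub_zero, abs_of_nonneg (by positivity)]
    refine le_trans ?_ hD.le
    rw [_root_.one_div_pow]
    refine one_div_le_one_div_of_le (by positivity) ?_
    rw [← Nat.cast_pow]
    refine Nat.cast_le.2 (le_trans ?_ (card_fixedVectors_map_le hρ M.1))
    rw [hcard]
    exact Nat.pow_le_pow_right Nat.card_pos (not_le.1 h).le

end Limits

/-! ### Haar measure and reduction modulo `ℓ ^ n` -/

section Haar

variable {G : Type*} [Group G] [TopologicalSpace G] [IsTopologicalGroup G] [CompactSpace G]
  [MeasurableSpace G] [BorelSpace G]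

theorem isProbabilityMeasure_haarMeasure_top :
    IsProbabilityMeasure (Measure.haarMeasure (⊤ : TopologicalSpace.PositiveCompacts G)) :=
  ⟨Measure.haarMeasure_self (K₀ := (⊤ : TopologicalSpace.PositiveCompacts G))⟩

/-- If the fibres of a map from a compact group to a finite set are measurable and left translates
of each other, the normalized Haar measure is mapped to the uniform distribution. -/
theorem haarMeasure_real_preimage {P : Type*} [Finite P] (π : G → P)
    (hm : ∀ p, MeasurableSet (π ⁻¹' {p})) (ht : ∀ p p', ∃ s, ∀ t, π t = p ↔ π (s * t) = p')
    (S : Set P) :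
    (Measure.haarMeasure (⊤ : TopologicalSpace.PositiveCompacts G)).real (π ⁻¹' S) =
      (Nat.card S : ℝ) / Nat.card P := by
  classical
  set μ := Measure.haarMeasure (⊤ : TopologicalSpace.PositiveCompacts G)
  have hμ : IsProbabilityMeasure μ := isProbabilityMeasure_haarMeasure_top
  have := Fintype.ofFinite P
  have heq : ∀ p p', μ.real (π ⁻¹' {p}) = μ.real (π ⁻¹' {p'}) := by
    intro p p'
    obtain ⟨s, hs⟩ := ht p p'
    rw [measureReal_def, measureReal_def, ← measure_preimage_mul μ s (π ⁻¹' {p'})]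
    congr 2
    ext t
    exact hs t
  let p₀ : P := π 1
  have hS : ∀ S : Set P, μ.real (π ⁻¹' S) = Nat.card S * μ.real (π ⁻¹' {p₀}) := by
    intro S
    have h1 : π ⁻¹' S = ⋃ p ∈ S.toFinset, π ⁻¹' {p} := by
      ext t
      simp
    rw [h1, measureReal_biUnion_finset
      (fun p _ p' _ h => Disjoint.preimage _ (Set.disjoint_singleton.2 h)) fun p _ => hm p,
      Finset.sum_congr rfl fun p _ => heq p p₀, Finset.sum_const, nsmul_eq_mul,
      Set.toFinset_card, Nat.card_eq_fintype_card]
  have h1 := hS Set.univ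
  rw [Set.preimage_univ, probReal_univ, Nat.card_univ] at h1
  have hP : (Nat.card P : ℝ) ≠ 0 := fun h => by
    rw [h, zero_mul] at h1
    exact one_ne_zero h1
  rw [hS S, eq_div_iff hP, mul_assoc, mul_comm (μ.real _), ← h1, mul_one]

end Haar

section Lifting

variable {R : Type*} [CommRing R] {g : ℕ}

/-- A linear automorphism that multiplies the symplectic pairing by a unit, as a matrix. -/
theorem GSp.exists_mulVec_eq (f f' : (Fin g ⊕ Fin g → R) →ₗ[R] (Fin g ⊕ Fin g → R))
    (h : f ∘ₗ f' = LinearMap.id) (h' : f' ∘ₗ f = LinearMap.id) (m : Rˣ)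
    (hm : ∀ x y, sp g R (f x) (f y) = m * sp g R x y) :
    ∃ M : GSp g R, ∀ v, M.1.1 *ᵥ v = f v := by
  refine ⟨⟨⟨LinearMap.toMatrix' f, LinearMap.toMatrix' f', ?_, ?_⟩, m, ?_⟩, fun v => ?_⟩
  · rw [← LinearMap.toMatrix'_comp, h, LinearMap.toMatrix'_id]
  · rw [← LinearMap.toMatrix'_comp, h', LinearMap.toMatrix'_id]
  · refine (Matrix.toBilin' (R₁ := R)).injective (LinearMap.ext₂ fun x y => ?_)
    rw [Matrix.toBilin'_apply', Matrix.toBilin'_apply', smul_mulVec, dotProduct_smul,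
      ← sp_eq_dotProduct, smul_eq_mul, ← hm, sp_eq_dotProduct, ← LinearMap.toMatrix'_mulVec f x,
      ← LinearMap.toMatrix'_mulVec f y, dotProduct_mulVec _ (J (Fin g) R),
      vecMul_mulVec, ← dotProduct_mulVec, mulVec_mulVec]
  · exact LinearMap.toMatrix'_mulVec f v

/-- The extension of a linear endomorphism of `R^{2g}` to `R^{2(g+1)}` that fixes the first vector
of the additional hyperbolic pair and multiplies the second one by `m`. -/
def spExtend (f : (Fin g ⊕ Fin g → R) →ₗ[R] (Fin g ⊕ Fin g → R)) (m : R) :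
    (Fin (g + 1) ⊕ Fin (g + 1) → R) →ₗ[R] (Fin (g + 1) ⊕ Fin (g + 1) → R) where
  toFun v := Sum.elim (Fin.cons (v (Sum.inl 0)) (f (spProj g R v) ∘ Sum.inl))
    (Fin.cons (m * v (Sum.inr 0)) (f (spProj g R v) ∘ Sum.inr))
  map_add' v w := by
    ext (k | k) <;> induction k using Fin.cases <;> simp [mul_add]
  map_smul' c v := by
    ext (k | k) <;> induction k using Fin.cases <;> simp [mul_left_comm]

theorem spProj_spExtend (f : (Fin g ⊕ Fin g → R) →ₗ[R] (Fin g ⊕ Fin g → R)) (m : R)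
    (v : Fin (g + 1) ⊕ Fin (g + 1) → R) : spProj g R (spExtend f m v) = f (spProj g R v) := by
  ext (k | k) <;> simp [spProj_apply, spExtend]

theorem spExtend_comp {f f' : (Fin g ⊕ Fin g → R) →ₗ[R] (Fin g ⊕ Fin g → R)} {m m' : R}
    (h : f ∘ₗ f' = LinearMap.id) (hm : m * m' = 1) :
    spExtend f m ∘ₗ spExtend f' m' = LinearMap.id := by
  refine LinearMap.ext fun v => ?_
  have h1 : f (spProj g R (spExtend f' m' v)) = spProj g R v := by
    rw [spProj_spExtend]
    exact LinearMap.congr_fun h _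
  have h2 : spExtend f m (spExtend f' m' v) = Sum.elim
    (Fin.cons (v (Sum.inl 0)) (spProj g R v ∘ Sum.inl))
    (Fin.cons (m * (m' * v (Sum.inr 0))) (spProj g R v ∘ Sum.inr)) := by
    rw [← h1]
    rfl
  rw [LinearMap.comp_apply, h2, ← mul_assoc, hm, one_mul]
  ext (k | k) <;> induction k using Fin.cases <;> simp [spProj_apply]

theorem GSp.exists_extend (M : GSp g R) :
    ∃ M' : GSp (g + 1) R, ∀ v, M'.1.1 *ᵥ spEmb g R v = spEmb g R (M.1.1 *ᵥ v) := by
  obtain ⟨m, hm⟩ := GSp.exists_sp_mulVec M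
  have h1 : Matrix.mulVecLin M.1.1 ∘ₗ Matrix.mulVecLin M⁻¹.1.1 = LinearMap.id :=
    LinearMap.ext fun v => GSp.mulVec_inv_mulVec M v
  have h2 : Matrix.mulVecLin M⁻¹.1.1 ∘ₗ Matrix.mulVecLin M.1.1 = LinearMap.id :=
    LinearMap.ext fun v => GSp.inv_mulVec_mulVec M v
  have hsucc : ∀ v w : Fin (g + 1) ⊕ Fin (g + 1) → R, sp (g + 1) R v w =
      v (Sum.inr 0) * w (Sum.inl 0) - v (Sum.inl 0) * w (Sum.inr 0) +
        sp g R (spProj g R v) (spProj g R w) := fun v w => by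
    simp only [sp_apply, spProj_apply, Fin.sum_univ_succ, Function.comp_apply, Sum.map_inl,
      Sum.map_inr]
    ring
  obtain ⟨M', hM'⟩ := GSp.exists_mulVec_eq (spExtend (Matrix.mulVecLin M.1.1) m)
    (spExtend (Matrix.mulVecLin M⁻¹.1.1) (m⁻¹ : Rˣ)) (spExtend_comp h1 m.mul_inv)
    (spExtend_comp h2 m.inv_mul) m fun x y => by
      rw [hsucc, hsucc x y, spProj_spExtend, spProj_spExtend, mulVecLin_apply, mulVecLin_apply, hm]
      simp only [spExtend, LinearMap.coe_mk, AddHom.coe_mk, Sum.elim_inl, Sum.elim_inr,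
        Fin.cons_zero]
      ring
  refine ⟨M', fun v => ?_⟩
  rw [hM']
  ext (k | k) <;> induction k using Fin.cases <;>
    simp only [spExtend, LinearMap.coe_mk, AddHom.coe_mk, spProj_spEmb] <;> simp [spEmb]

end Lifting

section Padic

variable (ℓ : ℕ) [Fact ℓ.Prime]

theorem PadicInt.toZModPow_surjective (n : ℕ) :
    Function.Surjective (PadicInt.toZModPow n : ℤ_[ℓ] →+* ZMod (ℓ ^ n)) :=
  ZMod.ringHom_surjective _

theorem PadicInt.continuous_toZModPow (n : ℕ) :
    Continuous (PadicInt.toZModPow n : ℤ_[ℓ] →+* ZMod (ℓ ^ n)) := by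
  refine continuous_of_continuousAt_zero (PadicInt.toZModPow n : ℤ_[ℓ] →+* ZMod (ℓ ^ n)) ?_
  refine tendsto_nhds_of_eventually_eq ?_
  have hpos : (0 : ℝ) < (ℓ : ℝ) ^ (-n : ℤ) := zpow_pos (Nat.cast_pos.2 (Fact.out : ℓ.Prime).pos) _
  filter_upwards [Metric.closedBall_mem_nhds (0 : ℤ_[ℓ]) hpos] with x hx
  rw [mem_closedBall_zero_iff, PadicInt.norm_le_pow_iff_mem_span_pow,
    ← PadicInt.ker_toZModPow, RingHom.mem_ker] at hx
  rw [hx, map_zero]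

theorem isLocalHom_castHom_pow {n : ℕ} (hn : n ≠ 0) :
    IsLocalHom (ZMod.castHom (dvd_pow_self ℓ hn) (ZMod ℓ)) := by
  refine ⟨fun a ha => ?_⟩
  have : NeZero (ℓ ^ n) := ⟨pow_ne_zero _ (Fact.out : ℓ.Prime).ne_zero⟩
  rw [← ZMod.natCast_zmod_val a] at ha ⊢
  rw [map_natCast, ZMod.isUnit_iff_coprime] at ha
  exact (ZMod.isUnit_iff_coprime _ _).2 (ha.pow_right n)

/-- The group of reductions modulo `ℓ ^ n` of the symplectic similitudes over `ℤ_ℓ`. -/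
noncomputable def redGSp (n g : ℕ) : Subgroup (GSp g (ZMod (ℓ ^ n))) :=
  (GSp.map g (PadicInt.toZModPow n : ℤ_[ℓ] →+* ZMod (ℓ ^ n))).range

theorem isStableFamily_redGSp (n : ℕ) : IsStableFamily (redGSp ℓ n) where
  transvection_mem g u c := by
    obtain ⟨u, rfl⟩ := (PadicInt.toZModPow_surjective ℓ n).comp_left u
    obtain ⟨c, rfl⟩ := PadicInt.toZModPow_surjective ℓ n c
    exact ⟨spTransvection u c, map_spTransvection (PadicInt.toZModPow_surjective ℓ n) u c⟩
  extend := by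
    rintro g _ ⟨M, rfl⟩
    obtain ⟨M', hM'⟩ := GSp.exists_extend M
    refine ⟨_, ⟨M', rfl⟩, fun v => ?_⟩
    obtain ⟨v, rfl⟩ := (PadicInt.toZModPow_surjective ℓ n).comp_left v
    have h : ∀ w : Fin g ⊕ Fin g → ℤ_[ℓ],
        (PadicInt.toZModPow n : ℤ_[ℓ] →+* ZMod (ℓ ^ n)) ∘ spEmb g _ w =
          spEmb g _ ((PadicInt.toZModPow n : ℤ_[ℓ] →+* ZMod (ℓ ^ n)) ∘ w) := fun w => by
      ext (k | k) <;> induction k using Fin.cases <;> simp [spEmb]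
    rw [← h, ← GSp.comp_mulVec, hM', h, GSp.comp_mulVec]

end Padic

/-! ### Fixed vertices and fixed ends -/

section Ends

variable {ℓ : ℕ} [Fact ℓ.Prime] {g : ℕ}

/-- The translation part modulo `ℓ ^ n` and the linear part modulo `ℓ ^ n`. -/
noncomputable def redAff (n : ℕ) (s : AffGSp ℓ g) :
    (Fin g ⊕ Fin g → ZMod (ℓ ^ n)) × redGSp ℓ n g :=
  (PadicInt.toZModPow n ∘ s.left.toAdd, ⟨GSp.map g (PadicInt.toZModPow n) s.right, s.right, rfl⟩)

theorem redAff_mul (n : ℕ) (s t : AffGSp ℓ g) :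
    redAff n (s * t) = ((redAff n s).1 + (redAff n s).2.1.1.1 *ᵥ (redAff n t).1,
      (redAff n s).2 * (redAff n t).2) := by
  refine Prod.ext ?_ (Subtype.ext (map_mul (GSp.map g (PadicInt.toZModPow n)) s.right t.right))
  change redVec g (PadicInt.toZModPow n) (s.left.toAdd + s.right.1.1 *ᵥ t.left.toAdd) = _
  rw [map_add, redVec_apply, redVec_apply, GSp.comp_mulVec]
  rfl

theorem smul_treeLevel_eq_iff (n : ℕ) (s : AffGSp ℓ g) (x : TreeLevel ℓ g n) :
    s • x = x ↔ (redAff n s).1 + (redAff n s).2.1.1.1 *ᵥ x.vec = x.vec :=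
  TreeLevel.ext_iff

/-- The affine map `x ↦ v + M x` has a fixed point if and only if `v` is in the image of `M - 1`. -/
theorem exists_add_mulVec_eq_iff {R : Type*} [CommRing R] (M : GSp g R) (v : Fin g ⊕ Fin g → R) :
    (∃ x, v + M.1.1 *ᵥ x = x) ↔ v ∈ LinearMap.range (Matrix.mulVecLin (M.1.1 - 1)) := by
  constructor
  · rintro ⟨x, hx⟩
    refine ⟨-x, ?_⟩
    rw [mulVecLin_apply, mulVec_neg, sub_mulVec, one_mulVec]
    nth_rw 2 [← hx]
    abel
  · rintro ⟨x, rfl⟩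
    refine ⟨-x, ?_⟩
    rw [mulVecLin_apply, mulVec_neg, sub_mulVec, one_mulVec]
    abel

theorem exists_smul_treeLevel_eq_iff (n : ℕ) (s : AffGSp ℓ g) :
    (∃ x : TreeLevel ℓ g n, s • x = x) ↔
      (redAff n s).1 ∈ LinearMap.range (Matrix.mulVecLin ((redAff n s).2.1.1.1 - 1)) := by
  rw [← exists_add_mulVec_eq_iff]
  constructor
  · rintro ⟨x, hx⟩
    exact ⟨x.vec, (smul_treeLevel_eq_iff n s x).1 hx⟩
  · rintro ⟨x, hx⟩
    exact ⟨⟨x⟩, (smul_treeLevel_eq_iff n s _).2 hx⟩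

theorem exists_end_of_add_mulVec_eq (s : AffGSp ℓ g) (x : Fin g ⊕ Fin g → ℤ_[ℓ])
    (hx : s.left.toAdd + s.right.1.1 *ᵥ x = x) :
    ∃ y : TreeEnds (TreeLevel ℓ g) (treeParent ℓ g), ∀ n, s • y.1 n = y.1 n := by
  refine ⟨⟨fun n => ⟨PadicInt.toZModPow n ∘ x⟩, fun n => TreeLevel.ext (funext fun i => ?_)⟩,
    fun n => (smul_treeLevel_eq_iff n s _).2 ?_⟩
  · exact RingHom.congr_fun (PadicInt.zmod_cast_comp_toZModPow n (n + 1) n.le_succ) (x i)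
  · change redVec g (PadicInt.toZModPow n) s.left.toAdd +
      (GSp.map g (PadicInt.toZModPow n) s.right).1.1 *ᵥ
        ((PadicInt.toZModPow n : ℤ_[ℓ] →+* ZMod (ℓ ^ n)) ∘ x) = redVec g (PadicInt.toZModPow n) x
    rw [← GSp.comp_mulVec, ← redVec_apply, ← map_add, hx]

/-- If the reduction of `M - 1` modulo `ℓ ^ n` has fewer than `ℓ ^ n` elements in its kernel, then
its cokernel is killed by `ℓ ^ (n - 1)`. By Nakayama's lemma the image of `M - 1` contains
`ℓ ^ (n - 1) ℤ_ℓ^{2g}`, so membership in this image can be tested modulo `ℓ ^ n`. -/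
theorem exists_end_of_card_lt {n : ℕ} (hn : n ≠ 0) (s : AffGSp ℓ g)
    (hfix : ∃ x : TreeLevel ℓ g n, s • x = x)
    (hcard : Nat.card (fixedVectors (redAff n s).2.1) < ℓ ^ n) :
    ∃ y : TreeEnds (TreeLevel ℓ g) (treeParent ℓ g), ∀ n, s • y.1 n = y.1 n := by
  have hℓ : ℓ.Prime := Fact.out
  have : NeZero (ℓ ^ n) := ⟨pow_ne_zero _ hℓ.ne_zero⟩
  suffices h : s.left.toAdd ∈ LinearMap.range (Matrix.mulVecLin (s.right.1.1 - 1)) by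
    obtain ⟨x, hx⟩ := (exists_add_mulVec_eq_iff s.right _).2 h
    exact exists_end_of_add_mulVec_eq s x hx
  set φ : ℤ_[ℓ] →+* ZMod (ℓ ^ n) := PadicInt.toZModPow n
  set I := LinearMap.range (Matrix.mulVecLin (s.right.1.1 - 1)) with hI
  set I' := LinearMap.range (Matrix.mulVecLin ((redAff n s).2.1.1.1 - 1)) with hI'
  -- membership modulo `ℓ ^ n`
  have hmem : ∀ w, redVec g φ w ∈ I' → ∃ y ∈ I, ∃ z, w = y + (ℓ : ℤ_[ℓ]) ^ n • z := by
    rintro w ⟨x, hx⟩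
    obtain ⟨x, rfl⟩ := redVec_surjective (PadicInt.toZModPow_surjective ℓ n) x
    have h1 : redVec g φ (w - (s.right.1.1 - 1) *ᵥ x) = 0 := by
      rw [map_sub, ← hx, sub_eq_zero]
      exact (redVec_sub_one_mulVec s.right x).symm
    have h2 : ∀ k, ∃ c, w k - ((s.right.1.1 - 1) *ᵥ x) k = (ℓ : ℤ_[ℓ]) ^ n * c := fun k => by
      have h3 : w k - ((s.right.1.1 - 1) *ᵥ x) k ∈ RingHom.ker φ := congrFun h1 k
      rw [PadicInt.ker_toZModPow] at h3
      exact Ideal.mem_span_singleton.1 h3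
    choose z hz using h2
    refine ⟨(s.right.1.1 - 1) *ᵥ x, ⟨x, rfl⟩, z, ?_⟩
    rw [← sub_eq_iff_eq_add']
    exact funext hz
  have hfin := Finite.of_surjective _ (Submodule.mkQ_surjective I')
  have hC : Nat.card ((Fin g ⊕ Fin g → ZMod (ℓ ^ n)) ⧸ I') < ℓ ^ n := by
    rwa [hI', card_quotient_range_eq_card_ker]
  have hkill : ∀ w, (ℓ : ℤ_[ℓ]) ^ (n - 1) • w ∈
      I ⊔ Ideal.span {(ℓ : ℤ_[ℓ])} • (Ideal.span {(ℓ : ℤ_[ℓ]) ^ (n - 1)} •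
        (⊤ : Submodule ℤ_[ℓ] (Fin g ⊕ Fin g → ℤ_[ℓ]))) := by
    intro w
    -- the order of an element of the cokernel is a power of `ℓ` smaller than `ℓ ^ n`
    have h1 : ℓ ^ (n - 1) • I'.mkQ (redVec g φ w) = 0 := by
      have h2 : addOrderOf (I'.mkQ (redVec g φ w)) ∣ ℓ ^ n := by
        rw [addOrderOf_dvd_iff_nsmul_eq_zero, ← map_nsmul, ← Nat.cast_smul_eq_nsmul (ZMod (ℓ ^ n)),
          ZMod.natCast_self, zero_smul, map_zero]
      obtain ⟨k, hk, hk'⟩ := (Nat.dvd_prime_pow hℓ).1 h2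
      have h3 : ℓ ^ k < ℓ ^ n :=
        hk' ▸ (Nat.le_of_dvd Nat.card_pos (addOrderOf_dvd_natCard _)).trans_lt hC
      have h4 : k < n := (Nat.pow_lt_pow_iff_right hℓ.one_lt).1 h3
      rw [← addOrderOf_dvd_iff_nsmul_eq_zero, hk']
      exact pow_dvd_pow _ (by omega)
    have h5 : redVec g φ ((ℓ : ℤ_[ℓ]) ^ (n - 1) • w) ∈ I' := by
      rw [← map_nsmul, Submodule.mkQ_apply, Submodule.Quotient.mk_eq_zero, ← map_nsmul,
        ← Nat.cast_smul_eq_nsmul ℤ_[ℓ], Nat.cast_pow] at h1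
      exact h1
    obtain ⟨y, hy, z, hz⟩ := hmem _ h5
    rw [hz]
    refine Submodule.add_mem_sup hy ?_
    obtain ⟨k, rfl⟩ := Nat.exists_eq_succ_of_ne_zero hn
    rw [Nat.succ_eq_add_one, Nat.add_sub_cancel, pow_succ', mul_smul]
    exact Submodule.smul_mem_smul (Ideal.mem_span_singleton_self _)
      (Submodule.smul_mem_smul (Ideal.mem_span_singleton_self _) trivial)
  have hle : Ideal.span {(ℓ : ℤ_[ℓ]) ^ (n - 1)} •
      (⊤ : Submodule ℤ_[ℓ] (Fin g ⊕ Fin g → ℤ_[ℓ])) ≤ I := by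
    refine Submodule.le_of_le_smul_of_le_jacobson_bot (I := Ideal.span {(ℓ : ℤ_[ℓ])})
      (IsNoetherian.noetherian _) ?_ ?_
    · rw [← PadicInt.maximalIdeal_eq_span_p]
      exact (IsLocalRing.jacobson_eq_maximalIdeal ⊥ bot_ne_top).ge
    · rw [Submodule.smul_le]
      intro r hr w _
      obtain ⟨c, rfl⟩ := Ideal.mem_span_singleton.1 hr
      rw [mul_smul]
      exact hkill _
  obtain ⟨y, hy, z, hz⟩ := hmem _ ((exists_smul_treeLevel_eq_iff n s).1 hfix)
  rw [hz]
  refine I.add_mem hy (hle ?_)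
  obtain ⟨k, rfl⟩ := Nat.exists_eq_succ_of_ne_zero hn
  rw [Nat.succ_eq_add_one, Nat.add_sub_cancel, pow_succ, mul_smul]
  exact Submodule.smul_mem_smul (Ideal.mem_span_singleton_self _) trivial

end Ends

section Measure

variable {ℓ : ℕ} [Fact ℓ.Prime] {g : ℕ}

instance (n : ℕ) : Finite (GSp g (ZMod (ℓ ^ n))) := by
  have : NeZero (ℓ ^ n) := ⟨pow_ne_zero _ (Fact.out : ℓ.Prime).ne_zero⟩
  infer_instance

theorem measurableSet_redAff_preimage (n : ℕ)
    (p : (Fin g ⊕ Fin g → ZMod (ℓ ^ n)) × redGSp ℓ n g) :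
    MeasurableSet (redAff n ⁻¹' {p} : Set (AffGSp ℓ g)) := by
  have hind : IsInducing (fun x : AffGSp ℓ g => (x.left, x.right)) := ⟨rfl⟩
  have hl : Continuous (fun x : AffGSp ℓ g => x.left.toAdd) :=
    continuous_toAdd.comp (continuous_fst.comp hind.continuous)
  have hr : Continuous (fun x : AffGSp ℓ g => x.right.1.1) :=
    Units.continuous_val.comp (continuous_subtype_val.comp (continuous_snd.comp hind.continuous))
  have h1 : Continuous fun x : AffGSp ℓ g =>
      (PadicInt.toZModPow n ∘ x.left.toAdd : Fin g ⊕ Fin g → ZMod (ℓ ^ n)) :=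
    continuous_pi fun i => (PadicInt.continuous_toZModPow ℓ n).comp ((continuous_apply i).comp hl)
  have h2 : Continuous fun x : AffGSp ℓ g => x.right.1.1.map (PadicInt.toZModPow n) :=
    hr.matrix_map (PadicInt.continuous_toZModPow ℓ n)
  have h3 : (redAff n ⁻¹' {p} : Set (AffGSp ℓ g)) =
      (fun x => (PadicInt.toZModPow n ∘ x.left.toAdd : Fin g ⊕ Fin g → ZMod (ℓ ^ n))) ⁻¹' {p.1} ∩
      (fun x => x.right.1.1.map (PadicInt.toZModPow n)) ⁻¹' {p.2.1.1.1} := by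
    ext x
    rw [Set.mem_inter_iff, Set.mem_preimage, Set.mem_preimage, Set.mem_preimage,
      Set.mem_singleton_iff, Set.mem_singleton_iff, Set.mem_singleton_iff, Prod.ext_iff]
    refine and_congr Iff.rfl ⟨fun h => ?_, fun h => ?_⟩
    · rw [← h]
      rfl
    · exact Subtype.ext (Subtype.ext (Units.ext h))
  rw [h3]
  exact ((isClosed_singleton.preimage h1).inter (isClosed_singleton.preimage h2)).measurableSet

theorem exists_redAff_mul_eq_iff (n : ℕ) (p p' : (Fin g ⊕ Fin g → ZMod (ℓ ^ n)) × redGSp ℓ n g) :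
    ∃ s : AffGSp ℓ g, ∀ t, redAff n t = p ↔ redAff n (s * t) = p' := by
  obtain ⟨M, hM⟩ := (p'.2 * p.2⁻¹).2
  obtain ⟨a, ha⟩ := (PadicInt.toZModPow_surjective ℓ n).comp_left
    (p'.1 - (p'.2 * p.2⁻¹).1.1.1 *ᵥ p.1)
  have hs : redAff n (⟨Multiplicative.ofAdd a, M⟩ : AffGSp ℓ g) =
      (p'.1 - (p'.2 * p.2⁻¹).1.1.1 *ᵥ p.1, p'.2 * p.2⁻¹) := Prod.ext ha (Subtype.ext hM)
  refine ⟨⟨Multiplicative.ofAdd a, M⟩, fun t => ?_⟩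
  rw [redAff_mul, hs, Prod.ext_iff, Prod.ext_iff, and_comm, and_comm (a := _ = p'.1)]
  refine and_congr ?_ ?_
  · rw [mul_assoc, mul_eq_left, inv_mul_eq_one, eq_comm]
  · rw [sub_add_eq_add_sub, sub_eq_iff_eq_add, add_right_inj]
    exact (GSp.mulVec_injective (p'.2 * p.2⁻¹).1).eq_iff.symm

/-- Conditionally on the linear part `M` modulo `ℓ ^ n`, an affine map has a fixed vertex at level
`n` with probability `|im (M - 1)| / ℓ^{2gn} = 1 / |ker (M - 1)|`. -/
theorem haarMeasure_real_fixed_treeLevel (n : ℕ) (Q : redGSp ℓ n g → Prop) [DecidablePred Q] :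
    (Measure.haarMeasure (⊤ : TopologicalSpace.PositiveCompacts (AffGSp ℓ g))).real
      {s | Q (redAff n s).2 ∧ ∃ x : TreeLevel ℓ g n, s • x = x} =
    groupMean (redGSp ℓ n g) fun M =>
      if Q M then 1 / (Nat.card (fixedVectors M.1) : ℝ) else 0 := by
  have : NeZero (ℓ ^ n) := ⟨pow_ne_zero _ (Fact.out : ℓ.Prime).ne_zero⟩
  let V := Fin g ⊕ Fin g → ZMod (ℓ ^ n)
  let S : Set (V × redGSp ℓ n g) :=
    {p | Q p.2 ∧ p.1 ∈ LinearMap.range (Matrix.mulVecLin (p.2.1.1.1 - 1))}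
  have hS : {s : AffGSp ℓ g | Q (redAff n s).2 ∧ ∃ x : TreeLevel ℓ g n, s • x = x} =
      redAff n ⁻¹' S := by
    ext s
    exact and_congr Iff.rfl (exists_smul_treeLevel_eq_iff n s)
  rw [hS, haarMeasure_real_preimage _ (measurableSet_redAff_preimage n)
    (exists_redAff_mul_eq_iff n) S]
  let _ := Fintype.ofFinite (redGSp ℓ n g)
  let e : S ≃ Σ M : redGSp ℓ n g,
      {v : V // Q M ∧ v ∈ LinearMap.range (Matrix.mulVecLin (M.1.1.1 - 1))} :=
    ((Equiv.prodComm _ _).subtypeEquiv fun _ => Iff.rfl).trans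
      (Equiv.subtypeProdEquivSigmaSubtype fun M v =>
        Q M ∧ v ∈ LinearMap.range (Matrix.mulVecLin (M.1.1.1 - 1)))
  rw [Nat.card_congr e, Nat.card_sigma, Nat.card_prod, groupMean, Nat.cast_sum, Nat.cast_mul,
    ← div_div, Finset.sum_div]
  refine congrArg (· / _) (Finset.sum_congr rfl fun M _ => ?_)
  have hV : (Nat.card V : ℝ) ≠ 0 := Nat.cast_ne_zero.2 Nat.card_pos.ne'
  have hK : (Nat.card (fixedVectors M.1) : ℝ) ≠ 0 := Nat.cast_ne_zero.2 Nat.card_pos.ne'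
  split_ifs with hQ
  · have h1 : Nat.card V = Nat.card (fixedVectors M.1) *
        Nat.card (LinearMap.range (Matrix.mulVecLin (M.1.1.1 - 1))) := by
      rw [Submodule.card_eq_card_quotient_mul_card
        (LinearMap.range (Matrix.mulVecLin (M.1.1.1 - 1))), card_quotient_range_eq_card_ker,
        mul_comm]
      rfl
    have h2 : Nat.card {v : V // Q M ∧ v ∈ LinearMap.range (Matrix.mulVecLin (M.1.1.1 - 1))} =
        Nat.card (LinearMap.range (Matrix.mulVecLin (M.1.1.1 - 1))) :=
      Nat.card_congr (Equiv.subtypeEquivRight fun v => and_iff_right hQ)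
    rw [h2, div_eq_div_iff hV hK, one_mul, h1, Nat.cast_mul, mul_comm]
  · have : IsEmpty {v : V // Q M ∧ v ∈ LinearMap.range (Matrix.mulVecLin (M.1.1.1 - 1))} :=
      ⟨fun v => hQ v.2.1⟩
    rw [Nat.card_of_isEmpty, Nat.cast_zero, zero_div]

/-- The fixed points at level `n` determine the density of the elements with a fixed end up to an
error that does not depend on `g`. -/
theorem abs_fixedEndDensityGSp_sub_le {n : ℕ} (hn : n ≠ 0) :
    |fixedEndDensityGSp ℓ g -
      groupMean (redGSp ℓ n g) fun M => 1 / (Nat.card (fixedVectors M.1) : ℝ)| ≤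
    (1 / (ℓ : ℝ)) ^ n := by
  classical
  have hℓ : (0 : ℝ) < ℓ := Nat.cast_pos.2 (Fact.out : ℓ.Prime).pos
  set μ := Measure.haarMeasure (⊤ : TopologicalSpace.PositiveCompacts (AffGSp ℓ g))
  have hμ : IsProbabilityMeasure μ := isProbabilityMeasure_haarMeasure_top
  set E := {s : AffGSp ℓ g | ∃ y : TreeEnds (TreeLevel ℓ g) (treeParent ℓ g),
    ∀ n, s • y.1 n = y.1 n} with hE
  let E' := {s : AffGSp ℓ g | True ∧ ∃ x : TreeLevel ℓ g n, s • x = x}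
  let Q : redGSp ℓ n g → Prop := fun M => ℓ ^ n ≤ Nat.card (fixedVectors M.1)
  let B := {s : AffGSp ℓ g | Q (redAff n s).2 ∧ ∃ x : TreeLevel ℓ g n, s • x = x}
  have h1 : μ.real E' =
      groupMean (redGSp ℓ n g) fun M => 1 / (Nat.card (fixedVectors M.1) : ℝ) := by
    have := haarMeasure_real_fixed_treeLevel (ℓ := ℓ) (g := g) n fun _ => True
    simpa only [if_true] using this
  have h2 : μ.real B ≤ (1 / (ℓ : ℝ)) ^ n := by
    rw [haarMeasure_real_fixed_treeLevel n Q]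
    have h3 := abs_groupMean_sub_le (G := redGSp ℓ n g)
      (f := fun M => if Q M then 1 / (Nat.card (fixedVectors M.1) : ℝ) else 0) (h := fun _ => 0)
      (k := fun _ => (1 / (ℓ : ℝ)) ^ n) fun M => by
        rw [sub_zero]
        split_ifs with h
        · rw [abs_of_nonneg (by positivity), _root_.one_div_pow]
          exact one_div_le_one_div_of_le (by positivity) (by exact_mod_cast h)
        · rw [abs_zero]
          positivity
    rw [groupMean_const, groupMean_const, sub_zero] at h3
    exact (le_abs_self _).trans h3
  have h3 : μ.real E ≤ μ.real E' := measureReal_mono fun s ⟨y, hy⟩ => ⟨trivial, y.1 n, hy n⟩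
  have h4 : μ.real E' ≤ μ.real E + μ.real B := by
    refine (measureReal_mono fun s hs => ?_).trans (measureReal_union_le E B)
    by_cases h : Q (redAff n s).2
    · exact Or.inr ⟨h, hs.2⟩
    · exact Or.inl (exists_end_of_card_lt hn s hs.2 (not_le.1 h))
  rw [← h1]
  change |μ.real E - μ.real E'| ≤ _
  rw [abs_le]
  constructor <;> linarith [show 0 ≤ (1 / (ℓ : ℝ)) ^ n by positivity]

end Measure

theorem mainTheorem12 (ℓ : ℕ) [Fact ℓ.Prime] (hodd : Odd ℓ) :
    ∃ L : ℝ, Tendsto (fun g : ℕ => fixedEndDensityGSp ℓ g) atTop (𝓝 L) := by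
  have hℓ : ℓ.Prime := Fact.out
  refine exists_tendsto_of_forall_approx fun ε hε => ?_
  obtain ⟨n, hn⟩ : ∃ n : ℕ, (1 / (ℓ : ℝ)) ^ n < ε := by
    refine exists_pow_lt_of_lt_one hε ?_
    rw [div_lt_one (Nat.cast_pos.2 hℓ.pos)]
    exact_mod_cast hℓ.one_lt
  have hn1 : (1 / (ℓ : ℝ)) ^ (n + 1) ≤ ε := by
    refine (pow_le_pow_of_le_one (by positivity) ?_ n.le_succ).trans hn.le
    rw [div_le_one (Nat.cast_pos.2 hℓ.pos)]
    exact_mod_cast hℓ.one_lt.le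
  have : NeZero (ℓ ^ (n + 1)) := ⟨pow_ne_zero _ hℓ.ne_zero⟩
  have := isLocalHom_castHom_pow ℓ n.succ_ne_zero
  have h2 : (2 : ZMod ℓ) ≠ 0 := by
    intro h
    have h3 : ℓ ∣ 2 := (ZMod.natCast_eq_zero_iff 2 ℓ).1 (by exact_mod_cast h)
    have h4 := (Nat.prime_dvd_prime_iff_eq hℓ Nat.prime_two).1 h3
    exact (Nat.not_odd_iff_even.2 (h4 ▸ even_two)) hodd
  exact ⟨_, exists_tendsto_groupMean_one_div (ρ := ZMod.castHom (dvd_pow_self ℓ n.succ_ne_zero)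
    (ZMod ℓ)) (ZMod.ringHom_surjective _) h2 (isStableFamily_redGSp ℓ (n + 1)),
    Eventually.of_forall fun g => (abs_fixedEndDensityGSp_sub_le n.succ_ne_zero).trans hn1⟩
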